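/- **Proposition 3.2 (resolvent estimates).** For $R>1$ let $\|\cdot\|_{L^2}$ and $\langle f,g\rangle=\int_1^R f\bar g\,dr$ denote the norm and inner product of $L^2((1,R),dr)$ (complex-valued functions), and put $$\|f\|_{H^1_r}^2=\|f'\|_{L^2}^2+\Big\|\frac fr\Big\|_{L^2}^2,\qquad \|f\|_{H^{-1}_r}=\sup\{|\langle f,g\rangle| : g\in H^1_0(1,R),\ \|g\|_{H^1_r}\le 1\}.$$ For $\nu>0$, $B\in\mathbb R\setminus\{0\}$ and $k\in\mathbb Z$ with $|k|\ge1$ let $$L_k=-\nu\Big(\partial_r^2-\frac{k^2-\frac14}{r^2}\Big)+\frac{ikB}{r^2},\qquad D_k=\{w\in H^2(1,R): w(1)=w(R)=0\}.$$ There exist constants $C,c>0$, independent of $\nu,k,B,\lambda,R$ (and of $w,c'$), such that the following holds for all $\nu>0$, $B\neq0$, $R>1$, $\lambda\in\mathbb R$, $k\in\mathbb Z$ with $|k|\ge1$, $w\in D_k$ and $0\le c'\le c$. Let $F=(L_k-ikB\lambda)w$ and let $\varphi\in H^2(1,R)$ be the stream function of $w$, i.e. $\big(\partial_r^2-\frac{k^2-1/4}{r^2}\big)\varphi=w$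 on $(1,R)$ with $\varphi(1)=\varphi(R)=0$. Then $$\nu^{\frac23}|kB|^{\frac13}\|w'\|_{L^2}+\nu^{\frac13}|kB|^{\frac23}\Big\|\frac wr\Big\|_{L^2}\le C\Big\|rF-c'\nu^{\frac13}|kB|^{\frac23}\frac wr\Big\|_{L^2},$$ $$\nu^{\frac16}|kB|^{\frac56}|k|^{\frac12}\Big(\|\varphi'\|_{L^2}+|k|\Big\|\frac{\varphi}{r}\Big\|_{L^2}\Big)\le CR^2\Big(\Big(\frac{\nu}{|kB|}\Big)^{\frac16}(\log R)^{\frac12}+1\Big)\Big\|rF-c'\nu^{\frac13}|kB|^{\frac23}\frac wr\Big\|_{L^2},$$ $$\nu\|w\|_{H^1_r}+\nu^{\frac23}|kB|^{\frac13}\Big\|\frac wr\Big\|_{L^2}\le C\big\|F-c'\nu^{\frac13}|kB|^{\frac23}R^{-2}w\big\|_{H^{-1}_r},$$ $$\nu^{\frac12}|kB|^{\frac12}\|\varphi'\|_{L^2}+\nu^{\frac12}|k||kB|^{\frac12}\Big\|\frac{\varphi}{r}\Big\|_{L^2}\le CR^2\big\|F-c'\nu^{\frac13}|kB|^{\frac23}R^{-2}w\big\|_{H^{-1}_r}.$$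 -/

import Mathlib

open MeasureTheory Set
open scoped ComplexConjugate

namespace TaylorCouette

/-- The derivative `f'` of a function of the radial variable on the interval `[1, R]` (one-sided
at the end points; values of `f` outside `[1, R]` play no role). -/
noncomputable def dr (R : ℝ) (f : ℝ → ℂ) : ℝ → ℂ :=
  derivWithin f (Icc 1 R)

/-- The norm of `L²((1, R), dr)`. -/
noncomputable def l2norm (R : ℝ) (f : ℝ → ℂ) : ℝ :=
  Real.sqrt (∫ r in Ioo 1 R, ‖f r‖ ^ 2)

/-- The inner product `⟨f, g⟩ = ∫₁ᴿ f ḡ dr` of `L²((1, R), dr)`. -/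
noncomputable def l2inner (R : ℝ) (f g : ℝ → ℂ) : ℂ :=
  ∫ r in Ioo 1 R, f r * conj (g r)

/-- The Sobolev space `H¹(1, R)` in one dimension, each class being given by its continuous
representative on `[1, R]`: `f` is absolutely continuous on `[1, R]` and `f' ∈ L²`. -/
structure MemH1 (R : ℝ) (f : ℝ → ℂ) : Prop where
  ac : AbsolutelyContinuousOnInterval f 1 R
  dr_memLp : MemLp (dr R f) 2 (volume.restrict (Ioo 1 R))

/-- The space `H¹₀(1, R)`: functions in `H¹(1, R)` that vanish at both end points. -/
structure MemH10 (R : ℝ) (f : ℝ → ℂ) : Prop where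
  memH1 : MemH1 R f
  left : f 1 = 0
  right : f R = 0

/-- The Sobolev space `H²(1, R)`: `f` is continuously differentiable on `[1, R]` and its derivative
belongs to `H¹(1, R)`, that is, `f'` is absolutely continuous and `f'' ∈ L²`. -/
structure MemH2 (R : ℝ) (f : ℝ → ℂ) : Prop where
  contDiffOn : ContDiffOn ℝ 1 f (Icc 1 R)
  dr_memH1 : MemH1 R (dr R f)

/-- The domain `D_k` of the operator `L_k` on `(1, R)` with the conditions `w(1) = w(R) = 0`.
As `1 / r²` is bounded above and below on `(1, R)`, the requirements
`w ∈ H²_loc ∩ L²` and `L_k w ∈ L²`, or `w, w'', w / r² ∈ L²`, mean `w ∈ H²(1, R)`, for every `k`. -/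
structure MemDomain (R : ℝ) (w : ℝ → ℂ) : Prop where
  memH2 : MemH2 R w
  left : w 1 = 0
  right : w R = 0

/-- The operator `Δ_k f = (∂_r² - (k² - 1/4) / r²) f`. -/
noncomputable def lapK (R : ℝ) (k : ℤ) (f : ℝ → ℂ) (r : ℝ) : ℂ :=
  dr R (dr R f) r - (((k : ℂ) ^ 2 - 1 / 4) / (r : ℂ) ^ 2) * f r

/-- The operator `L_k w = -ν (∂_r² - (k² - 1/4) / r²) w + (i k B / r²) w`. -/
noncomputable def opL (ν B R : ℝ) (k : ℤ) (w : ℝ → ℂ) (r : ℝ) : ℂ :=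
  -(ν : ℂ) * lapK R k w r + (Complex.I * k * B / (r : ℂ) ^ 2) * w r

/-- The right-hand side `F = (L_k - i k B lam) w` of the resolvent equation. -/
noncomputable def resolventF (ν B R lam : ℝ) (k : ℤ) (w : ℝ → ℂ) (r : ℝ) : ℂ :=
  opL ν B R k w r - Complex.I * k * B * lam * w r

/-- The stream function `φ` of `w`: `φ ∈ H²(1, R)` solves
`(∂_r² - (k² - 1/4) / r²) φ = w` on `(1, R)` with `φ(1) = φ(R) = 0`. -/
structure IsStream (R : ℝ) (k : ℤ) (w φ : ℝ → ℂ) : Prop where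
  memH2 : MemH2 R φ
  eqn : ∀ᵐ r ∂(volume.restrict (Ioo 1 R)), lapK R k φ r = w r
  left : φ 1 = 0
  right : φ R = 0

/-- The norm `‖f‖_{H¹_r} = (‖f'‖² + ‖f / r‖²)^{1/2}`. -/
noncomputable def h1norm (R : ℝ) (f : ℝ → ℂ) : ℝ :=
  Real.sqrt (l2norm R (dr R f) ^ 2 + l2norm R (fun r => f r / r) ^ 2)

/-- The dual norm `‖f‖_{H⁻¹_r} = sup { |⟨f, g⟩| : ‖g‖_{H¹_r} ≤ 1 }`, with test functions `g` in
`H¹₀(1, R)`. For `f ∈ L²(1, R)` the set is bounded, as `|⟨f, g⟩| ≤ ‖r f‖ ‖g / r‖`. -/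
noncomputable def hm1norm (R : ℝ) (f : ℝ → ℂ) : ℝ :=
  sSup {x : ℝ | ∃ g : ℝ → ℂ, MemH10 R g ∧ h1norm R g ≤ 1 ∧ x = ‖l2inner R f g‖}

end TaylorCouette

/-! Write β = |kB| and δ = (ν/β)^{1/3}, so that ν = βδ³. Every coefficient in the estimates is then
β times a power of θ = δ^{1/2}, and δ is the relative width of the critical layer where 1/r² = λ.

Two tests of the equation bound w. Testing with w and taking real parts removes the imaginary
potential and leaves the dissipation (`energy_le`). Testing with pw and taking imaginary parts gives
βδ‖w/r‖² up to a commutator with p' and the mass of w inside the layer (`layer_estimate`). Here p is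
a real multiplier imitating δ/(1 - λr²), smoothed at scale δ, with (1 - λr²)p = δ(1 - σ²) and σ a
bump on the layer (`exists_isMultiplier`). The layer mass is small: ‖σf/r‖² ≤ 10δ‖f/r‖‖f'‖, by a
Hardy identity whose weight A has size δ and nearly satisfies -rA' = σ² (`l2norm_layer_sq_le`). The
two inequalities close algebraically in `weighted_bounds` and `dual_bounds`. When δ > 1 no layer is
needed: energy and Hardy suffice.

For the stream function, ‖φ'‖² + (k² - 1/4)‖φ/r‖² = -⟨w, φ⟩. Since (1/r² - λ)r²p = δ(1 - σ²),
testing the equation with r²pφ recovers δ⟨w, φ⟩ up to a layer term (`stream_layer_estimate`). The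
weight r² is what costs R². The small layer mass of φ yields the additional powers of θ and, in the
weighted estimate, of |k|.

The shift by c' is real. It drops out of imaginary parts, and elsewhere is absorbed because c' is
small. -/

namespace TaylorCouette

/-! ### The L² norm and pairing on (1, R) -/

section LTwo

variable {R : ℝ}

lemma memLp_of_continuousOn {E : Type*} [NormedAddCommGroup E] {f : ℝ → E}
    (hf : ContinuousOn f (Icc 1 R)) : MemLp f 2 (volume.restrict (Ioo 1 R)) := by
  obtain ⟨C, hC⟩ := isCompact_Icc.exists_bound_of_continuousOn hf
  refine MemLp.of_bound ((hf.mono Ioo_subset_Icc_self).aestronglyMeasurable measurableSet_Ioo) C ?_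
  filter_upwards [ae_restrict_mem measurableSet_Ioo] with r hr
  exact hC r (Ioo_subset_Icc_self hr)

lemma integrable_of_continuousOn {E : Type*} [NormedAddCommGroup E] {f : ℝ → E}
    (hf : ContinuousOn f (Icc 1 R)) : Integrable f (volume.restrict (Ioo 1 R)) :=
  (hf.integrableOn_Icc).mono_set Ioo_subset_Icc_self

lemma l2norm_nonneg (R : ℝ) (f : ℝ → ℂ) : 0 ≤ l2norm R f := Real.sqrt_nonneg _

lemma l2norm_sq (R : ℝ) (f : ℝ → ℂ) : l2norm R f ^ 2 = ∫ r in Ioo 1 R, ‖f r‖ ^ 2 :=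
  Real.sq_sqrt (integral_nonneg fun _ => by positivity)

lemma integrable_mul_conj {f g : ℝ → ℂ} (hf : MemLp f 2 (volume.restrict (Ioo 1 R)))
    (hg : MemLp g 2 (volume.restrict (Ioo 1 R))) :
    Integrable (fun r => f r * conj (g r)) (volume.restrict (Ioo 1 R)) :=
  MemLp.integrable_mul hf hg.star

lemma integral_norm_mul_norm_le {f g : ℝ → ℂ} (hf : MemLp f 2 (volume.restrict (Ioo 1 R)))
    (hg : MemLp g 2 (volume.restrict (Ioo 1 R))) :
    ∫ r in Ioo 1 R, ‖f r‖ * ‖g r‖ ≤ l2norm R f * l2norm R g := by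
  have h := integral_mul_norm_le_Lp_mul_Lq (μ := volume.restrict (Ioo 1 R)) (f := f) (g := g)
    Real.HolderConjugate.two_two (by simpa using hf) (by simpa using hg)
  simpa [l2norm, Real.sqrt_eq_rpow] using h

lemma norm_l2inner_le {f g : ℝ → ℂ} (hf : MemLp f 2 (volume.restrict (Ioo 1 R)))
    (hg : MemLp g 2 (volume.restrict (Ioo 1 R))) :
    ‖l2inner R f g‖ ≤ l2norm R f * l2norm R g := by
  refine (norm_integral_le_integral_norm _).trans (le_trans (le_of_eq ?_)
    (integral_norm_mul_norm_le hf hg))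
  simp

/-- Minkowski's inequality combined with monotonicity of the norm, in the form in which all later
norm comparisons are made. -/
lemma l2norm_le_add {h f g : ℝ → ℂ} (hh : MemLp h 2 (volume.restrict (Ioo 1 R)))
    (hf : MemLp f 2 (volume.restrict (Ioo 1 R)))
    (hg : MemLp g 2 (volume.restrict (Ioo 1 R))) {a b : ℝ} (ha : 0 ≤ a) (hb : 0 ≤ b)
    (H : ∀ r ∈ Ioo 1 R, ‖h r‖ ≤ a * ‖f r‖ + b * ‖g r‖) :
    l2norm R h ≤ a * l2norm R f + b * l2norm R g := by
  have key : l2norm R h ^ 2 ≤ (a * l2norm R f + b * l2norm R g) ^ 2 := by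
    have i1 := hf.norm.integrable_sq
    have i2 := hg.norm.integrable_sq
    have i3 : Integrable (fun r => ‖f r‖ * ‖g r‖) (volume.restrict (Ioo 1 R)) :=
      hf.norm.integrable_mul hg.norm
    calc l2norm R h ^ 2 = ∫ r in Ioo 1 R, ‖h r‖ ^ 2 := l2norm_sq R h
      _ ≤ ∫ r in Ioo 1 R, (a ^ 2 * ‖f r‖ ^ 2 + 2 * a * b * (‖f r‖ * ‖g r‖) + b ^ 2 * ‖g r‖ ^ 2) := by
          refine setIntegral_mono_on hh.norm.integrable_sq
            (((i1.const_mul _).add (i3.const_mul _)).add (i2.const_mul _)) measurableSet_Ioo ?_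
          intro r hr
          have := pow_le_pow_left₀ (norm_nonneg _) (H r hr) 2
          linarith
      _ = a ^ 2 * l2norm R f ^ 2 + 2 * a * b * (∫ r in Ioo 1 R, ‖f r‖ * ‖g r‖)
            + b ^ 2 * l2norm R g ^ 2 := by
          have j : Integrable (fun r => a ^ 2 * ‖f r‖ ^ 2 + 2 * a * b * (‖f r‖ * ‖g r‖))
              (volume.restrict (Ioo 1 R)) := (i1.const_mul _).add (i3.const_mul _)
          rw [integral_add j (i2.const_mul _),
            integral_add (i1.const_mul _) (i3.const_mul _), integral_const_mul, integral_const_mul,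
            integral_const_mul, l2norm_sq, l2norm_sq]
      _ ≤ a ^ 2 * l2norm R f ^ 2 + 2 * a * b * (l2norm R f * l2norm R g)
            + b ^ 2 * l2norm R g ^ 2 := by
          have := mul_le_mul_of_nonneg_left (integral_norm_mul_norm_le hf hg)
            (by positivity : 0 ≤ 2 * a * b)
          linarith
      _ = _ := by ring
  exact le_of_sq_le_sq key
    (add_nonneg (mul_nonneg ha (l2norm_nonneg _ _)) (mul_nonneg hb (l2norm_nonneg _ _)))

end LTwo

/-- Continuously differentiable functions on `[1, R]` that vanish at both end points. -/
structure IsTest (R : ℝ) (g : ℝ → ℂ) : Prop where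
  contDiffOn : ContDiffOn ℝ 1 g (Icc 1 R)
  left : g 1 = 0
  right : g R = 0

/-! ### Test functions and integration by parts -/

section Calculus

variable {R : ℝ}

lemma continuousOn_dr (hR : 1 < R) {f : ℝ → ℂ} (hf : ContDiffOn ℝ 1 f (Icc 1 R)) :
    ContinuousOn (dr R f) (Icc 1 R) :=
  hf.continuousOn_derivWithin (uniqueDiffOn_Icc hR) le_rfl

lemma hasDerivAt_dr {f : ℝ → ℂ} (hf : ContDiffOn ℝ 1 f (Icc 1 R)) {r : ℝ} (hr : r ∈ Ioo 1 R) :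
    HasDerivAt f (dr R f r) r :=
  ((hf.differentiableOn one_ne_zero r (Ioo_subset_Icc_self hr)).hasDerivWithinAt).hasDerivAt
    (Icc_mem_nhds hr.1 hr.2)

lemma continuousOn_div_r {f : ℝ → ℂ} (hf : ContinuousOn f (Icc 1 R)) :
    ContinuousOn (fun r => f r / r) (Icc 1 R) := by
  refine hf.div Complex.continuous_ofReal.continuousOn fun r hr => ?_
  have : (0 : ℝ) < r := by linarith [hr.1]
  exact_mod_cast this.ne'

/-- C¹ functions are admissible in the supremum defining the dual norm. The proof only ever tests
with w, pw and r²pφ, which are all C¹. -/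
lemma IsTest.memH10 (hR : 1 < R) {g : ℝ → ℂ} (hg : IsTest R g) : MemH10 R g where
  memH1 := ⟨ContDiffOn.absolutelyContinuousOnInterval (by
      rw [uIcc_of_le hR.le]; exact hg.contDiffOn),
    memLp_of_continuousOn (continuousOn_dr hR hg.contDiffOn)⟩
  left := hg.left
  right := hg.right

lemma MemDomain.isTest {w : ℝ → ℂ} (hw : MemDomain R w) : IsTest R w :=
  ⟨hw.memH2.contDiffOn, hw.left, hw.right⟩

lemma IsTest.mul_ofReal {g : ℝ → ℂ} (hg : IsTest R g) {p : ℝ → ℝ} (hp : ContDiff ℝ 1 p) :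
    IsTest R (fun r => (p r : ℂ) * g r) :=
  ⟨(Complex.ofRealCLM.contDiff.comp hp).contDiffOn.mul hg.contDiffOn, by simp [hg.left],
    by simp [hg.right]⟩

lemma dr_mul_ofReal {g : ℝ → ℂ} (hg : ContDiffOn ℝ 1 g (Icc 1 R)) {p : ℝ → ℝ}
    (hp : ContDiff ℝ 1 p) {r : ℝ} (hr : r ∈ Ioo 1 R) :
    dr R (fun r => (p r : ℂ) * g r) r = ((deriv p r : ℝ) : ℂ) * g r + p r * dr R g r := by
  have h1 := ((hp.differentiable one_ne_zero r).hasDerivAt).ofReal_comp.mul (hasDerivAt_dr hg hr)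
  rw [dr, derivWithin_of_mem_nhds (Icc_mem_nhds hr.1 hr.2)]
  exact h1.deriv

/-- Passes absolute continuity to real and imaginary parts. -/
lemma absolutelyContinuousOnInterval_of_dist_le {f : ℝ → ℂ} {g : ℝ → ℝ} {a b : ℝ}
    (hf : AbsolutelyContinuousOnInterval f a b)
    (h : ∀ x y, dist (g x) (g y) ≤ dist (f x) (f y)) :
    AbsolutelyContinuousOnInterval g a b := by
  rw [absolutelyContinuousOnInterval_iff] at hf ⊢
  intro ε hε
  obtain ⟨δ, hδ, H⟩ := hf ε hε
  exact ⟨δ, hδ, fun E hE hE' =>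
    (Finset.sum_le_sum fun i _ => h _ _).trans_lt (H E hE hE')⟩

/-- The fundamental theorem of calculus for complex-valued absolutely continuous functions. -/
lemma integral_deriv_eq_sub_complex {f : ℝ → ℂ} {a b : ℝ} (hab : a ≤ b)
    (hf : AbsolutelyContinuousOnInterval f a b)
    (hint : Integrable (deriv f) (volume.restrict (Ioo a b))) :
    ∫ r in Ioo a b, deriv f r = f b - f a := by
  have hd : ∀ᵐ x, x ∈ uIcc a b → DifferentiableAt ℝ f x :=
    hf.boundedVariationOn.ae_differentiableAt_of_mem_uIcc
  -- The real-valued fundamental theorem is applied to the real and imaginary parts separately.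
  have hre := absolutelyContinuousOnInterval_of_dist_le (g := fun x => (f x).re) hf
    (fun x y => by
      rw [Real.dist_eq, ← Complex.sub_re, Complex.dist_eq]; exact Complex.abs_re_le_norm _)
  have him := absolutelyContinuousOnInterval_of_dist_le (g := fun x => (f x).im) hf
    (fun x y => by
      rw [Real.dist_eq, ← Complex.sub_im, Complex.dist_eq]; exact Complex.abs_im_le_norm _)
  have ere := hre.integral_deriv_eq_sub
  have eim := him.integral_deriv_eq_sub
  rw [intervalIntegral.integral_of_le hab, integral_Ioc_eq_integral_Ioo] at ere eim
  have hd' : ∀ᵐ x ∂(volume.restrict (Ioo a b)), DifferentiableAt ℝ f x := by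
    rw [ae_restrict_iff' measurableSet_Ioo]
    filter_upwards [hd] with x hx hx'
    exact hx (by rw [uIcc_of_le hab]; exact Ioo_subset_Icc_self hx')
  have cre : ∫ r in Ioo a b, deriv (fun x => (f x).re) r = ∫ r in Ioo a b, (deriv f r).re := by
    refine integral_congr_ae ?_
    filter_upwards [hd'] with x hx
    exact (Complex.reCLM.hasFDerivAt.comp_hasDerivAt x hx.hasDerivAt).deriv
  have cim : ∫ r in Ioo a b, deriv (fun x => (f x).im) r = ∫ r in Ioo a b, (deriv f r).im := by
    refine integral_congr_ae ?_
    filter_upwards [hd'] with x hx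
    exact (Complex.imCLM.hasFDerivAt.comp_hasDerivAt x hx.hasDerivAt).deriv
  apply Complex.ext
  · have := Complex.reCLM.integral_comp_comm hint
    simp only [Complex.reCLM_apply] at this
    rw [← this, ← cre, ere, Complex.sub_re]
  · have := Complex.imCLM.integral_comp_comm hint
    simp only [Complex.imCLM_apply] at this
    rw [← this, ← cim, eim, Complex.sub_im]

/-- Integration by parts against a test function. -/
lemma l2inner_dr_eq_neg (hR : 1 < R) {f g : ℝ → ℂ} (hf : MemH1 R f) (hg : IsTest R g) :
    l2inner R (dr R f) g = - l2inner R f (dr R g) := by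
  have hfc : ContinuousOn f (Icc 1 R) := by
    have := hf.ac.continuousOn
    rwa [uIcc_of_le hR.le] at this
  have hgc := hg.contDiffOn.continuousOn
  have hgac : AbsolutelyContinuousOnInterval (fun r => conj (g r)) 1 R := by
    refine ContDiffOn.absolutelyContinuousOnInterval ?_
    rw [uIcc_of_le hR.le]
    exact Complex.conjCLE.contDiff.comp_contDiffOn hg.contDiffOn
  have hac : AbsolutelyContinuousOnInterval (fun r => f r * conj (g r)) 1 R := hf.ac.smul hgac
  have hd : ∀ᵐ x ∂(volume.restrict (Ioo 1 R)), DifferentiableAt ℝ f x := by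
    rw [ae_restrict_iff' measurableSet_Ioo]
    have : ∀ᵐ x, x ∈ uIcc 1 R → DifferentiableAt ℝ f x :=
      hf.ac.boundedVariationOn.ae_differentiableAt_of_mem_uIcc
    filter_upwards [this] with x hx hx'
    exact hx (by rw [uIcc_of_le hR.le]; exact Ioo_subset_Icc_self hx')
  have hderiv : (fun r => deriv (fun r => f r * conj (g r)) r) =ᵐ[volume.restrict (Ioo 1 R)]
      fun r => dr R f r * conj (g r) + f r * conj (dr R g r) := by
    filter_upwards [hd, ae_restrict_mem measurableSet_Ioo] with r hr hr'
    have h1 : dr R f r = deriv f r := derivWithin_of_mem_nhds (Icc_mem_nhds hr'.1 hr'.2)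
    rw [h1]
    exact (hr.hasDerivAt.mul (Complex.conjCLE.hasFDerivAt.comp_hasDerivAt r
      (hasDerivAt_dr hg.contDiffOn hr'))).deriv
  have i1 := integrable_mul_conj hf.dr_memLp (memLp_of_continuousOn hgc)
  have i2 := integrable_mul_conj (memLp_of_continuousOn hfc)
    (memLp_of_continuousOn (continuousOn_dr hR hg.contDiffOn))
  have h0 := integral_deriv_eq_sub_complex hR.le hac ((i1.add i2).congr hderiv.symm)
  rw [integral_congr_ae hderiv, integral_add i1 i2] at h0
  simp only [hg.left, hg.right, map_zero, mul_zero, sub_zero] at h0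
  exact eq_neg_of_add_eq_zero_left h0

end Calculus

/-! ### Critical-layer multipliers -/

section Multiplier

/-- Multipliers adapted to the critical layer of width `δ` around the zero of `1 / r ^ 2 - lam`;
`σ` is a bump concentrated in the layer, and `A` a primitive controlling `σ ^ 2`. -/
structure IsMultiplier (lam δ : ℝ) (p A σ : ℝ → ℝ) : Prop where
  contDiff_p : ContDiff ℝ 1 p
  contDiff_A : ContDiff ℝ 1 A
  continuous_σ : Continuous σ
  σ_nonneg : ∀ r, 0 ≤ σ r
  σ_le_one : ∀ r, σ r ≤ 1
  abs_p_le : ∀ r, |p r| ≤ σ r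
  abs_deriv_p_le : ∀ r, 0 < r → |r * deriv p r| ≤ 3 / δ * σ r
  mul_p : ∀ r, (1 - lam * r ^ 2) * p r = δ * (1 - σ r ^ 2)
  abs_A_le : ∀ r, |A r| ≤ 2 * δ
  σ_sq_le : ∀ r, 0 < r → σ r ^ 2 ≤ -(r * deriv A r) + δ ^ 2

/-- For λ > 0 the function x = (1 - λr²)/(1 + λr²) is a bounded coordinate vanishing exactly at the
critical radius, with rx' = -(1 - x²) independently of λ. Taking p = δxη/(x² + δ²), σ² = δ²/(x² +
δ²) and A = δ arctan(x/δ) makes all bounds uniform in λ. For λ ≤ 0 there is no critical point; x is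
then constantly 1 and the same formulas apply. -/
lemma exists_isMultiplier (lam : ℝ) {δ : ℝ} (hδ : 0 < δ) (hδ1 : δ ≤ 1) :
    ∃ p A σ : ℝ → ℝ, IsMultiplier lam δ p A σ := by
  set m := max lam 0 with hm
  have hm0 : 0 ≤ m := le_max_right _ _
  have hden : ∀ r : ℝ, 0 < 1 + m * r ^ 2 := fun r => by positivity
  have hden' : ∀ r : ℝ, 0 < 1 + |lam| * r ^ 2 := fun r => by positivity
  set x : ℝ → ℝ := fun r => (1 - m * r ^ 2) / (1 + m * r ^ 2) with hx
  set η : ℝ → ℝ := fun r => 1 / (1 + |lam| * r ^ 2) with hη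
  have hx1 : ∀ r, x r ^ 2 ≤ 1 := fun r => by
    rw [hx, div_pow, div_le_one (by have := hden r; positivity)]
    have : 0 ≤ m * r ^ 2 := by positivity
    nlinarith
  have hη0 : ∀ r, 0 < η r := fun r => one_div_pos.2 (hden' r)
  have hη1 : ∀ r, η r ≤ 1 := fun r => by
    rw [hη]
    have : 0 ≤ |lam| * r ^ 2 := by positivity
    exact (div_le_one (hden' r)).2 (by linarith)
  -- The factor η converts 1 - λr² into x: for λ ≥ 0 one has (1 - λr²)η = x, and for λ ≤ 0 one has
  -- (1 - λr²)η = 1 = x.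
  have hxη : ∀ r, (1 - lam * r ^ 2) * (x r * η r) = x r ^ 2 := fun r => by
    have h1 := hden r
    have h2 := hden' r
    rcases le_total lam 0 with h | h
    · have hm' : m = 0 := max_eq_right h
      have hl : |lam| = -lam := abs_of_nonpos h
      rw [hl] at h2
      have h3 : 1 - lam * r ^ 2 ≠ 0 := by linarith
      simp only [hx, hη, hm', hl, zero_mul, sub_zero, add_zero, div_one, one_pow, one_mul, neg_mul,
        ← sub_eq_add_neg]
      exact mul_one_div_cancel h3
    · have hm' : m = lam := max_eq_left h
      have hl : |lam| = lam := abs_of_nonneg h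
      rw [hl] at h2
      simp only [hx, hη, hm', hl]
      field_simp
  have cx : ContDiff ℝ 1 x := by
    apply ContDiff.div <;> [fun_prop; fun_prop; exact fun r => (hden r).ne']
  have cη : ContDiff ℝ 1 η := by
    apply ContDiff.div <;> [fun_prop; fun_prop; exact fun r => (hden' r).ne']
  have dx : ∀ r, 0 < r → HasDerivAt x (-(1 - x r ^ 2) / r) r := fun r hr => by
    have h := ((((hasDerivAt_pow 2 r).const_mul m).const_sub 1).div
      (((hasDerivAt_pow 2 r).const_mul m).const_add 1) (hden r).ne')
    convert! h using 1
    have := hden r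
    simp only [hx]
    field_simp
    ring
  have dη : ∀ r, 0 < r → HasDerivAt η (-2 * η r * (1 - η r) / r) r := fun r hr => by
    have h := ((hasDerivAt_const r (1 : ℝ)).div
      (((hasDerivAt_pow 2 r).const_mul |lam|).const_add 1) (hden' r).ne')
    convert! h using 1
    have := hden' r
    simp only [hη]
    field_simp
    ring
  -- From here only the bounds, the identity `hxη` and the differential equations for x and η
  -- matter.
  clear_value x η
  have hD : ∀ r, 0 < x r ^ 2 + δ ^ 2 := fun r => by positivity
  have hq : ∀ r, 0 < √(x r ^ 2 + δ ^ 2) := fun r => Real.sqrt_pos.2 (hD r)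
  have hq2 : ∀ r, √(x r ^ 2 + δ ^ 2) ^ 2 = x r ^ 2 + δ ^ 2 := fun r => Real.sq_sqrt (hD r).le
  have hqx : ∀ r, |x r| ≤ √(x r ^ 2 + δ ^ 2) := fun r =>
    Real.le_sqrt_of_sq_le (by rw [sq_abs]; nlinarith)
  have hqδ : ∀ r, δ ≤ √(x r ^ 2 + δ ^ 2) := fun r =>
    Real.le_sqrt_of_sq_le (by nlinarith [sq_nonneg (x r)])
  have hp : ∀ r, |δ * (x r * η r) / (x r ^ 2 + δ ^ 2)| ≤ δ * |x r| / (x r ^ 2 + δ ^ 2) := fun r => by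
    rw [abs_div, abs_of_pos (hD r), abs_mul, abs_of_pos hδ, abs_mul, abs_of_pos (hη0 r)]
    have := hD r
    gcongr
    exact mul_le_of_le_one_right (abs_nonneg _) (hη1 r)
  have hxq : ∀ r, δ * |x r| / (x r ^ 2 + δ ^ 2) ≤ δ / √(x r ^ 2 + δ ^ 2) := fun r => by
    rw [div_le_div_iff₀ (hD r) (hq r)]
    nth_rw 2 [← hq2 r]
    have := mul_le_mul_of_nonneg_right (hqx r) (mul_pos hδ (hq r)).le
    nlinarith
  refine ⟨fun r => δ * (x r * η r) / (x r ^ 2 + δ ^ 2), fun r => δ * Real.arctan (x r / δ),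
    fun r => δ / √(x r ^ 2 + δ ^ 2), ?_, ?_, ?_, ?_, ?_, ?_, ?_, ?_, ?_, ?_⟩
  · exact (contDiff_const.mul (cx.mul cη)).div ((cx.pow 2).add contDiff_const) fun r => (hD r).ne'
  · exact contDiff_const.mul (Real.contDiff_arctan.comp (cx.div_const δ))
  · exact continuous_const.div (((cx.continuous.pow 2).add continuous_const).sqrt)
      fun r => (hq r).ne'
  · exact fun r => div_nonneg hδ.le (hq r).le
  · exact fun r => (div_le_one (hq r)).2 (hqδ r)
  · exact fun r => (hp r).trans (hxq r)
  · intro r hr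
    have hd := (((dx r hr).mul (dη r hr)).const_mul δ).div
      (((dx r hr).pow 2).add_const (δ ^ 2)) (hD r).ne'
    have he : r * deriv (fun r => δ * (x r * η r) / (x r ^ 2 + δ ^ 2)) r
        = -(δ * (η r * (1 - x r ^ 2) * (δ ^ 2 - x r ^ 2) / (x r ^ 2 + δ ^ 2)) / (x r ^ 2 + δ ^ 2))
          - 2 * (1 - η r) * (δ * (x r * η r) / (x r ^ 2 + δ ^ 2)) := by
      refine (congrArg (r * ·) hd.deriv).trans ?_
      have := hD r
      simp only [Pi.mul_apply, Pi.pow_apply]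
      field_simp
      ring
    rw [he]
    have b1 : |η r * (1 - x r ^ 2) * (δ ^ 2 - x r ^ 2) / (x r ^ 2 + δ ^ 2)| ≤ 1 := by
      rw [abs_div, abs_of_pos (hD r), div_le_one (hD r), abs_mul,
        abs_of_nonneg (mul_nonneg (hη0 r).le (by linarith [hx1 r]))]
      have h1 : η r * (1 - x r ^ 2) ≤ 1 :=
        mul_le_one₀ (hη1 r) (by linarith [hx1 r]) (by linarith [sq_nonneg (x r)])
      have h2 : |δ ^ 2 - x r ^ 2| ≤ x r ^ 2 + δ ^ 2 := by
        rw [abs_le]; constructor <;> nlinarith [sq_nonneg (x r), sq_nonneg δ]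
      calc _ ≤ 1 * |δ ^ 2 - x r ^ 2| := by gcongr
        _ ≤ _ := by linarith
    -- The target is 3/√(x² + δ²): one unit pays for the derivative of x/(x² + δ²) and x-part of η',
    -- two units for the remaining term 2(1 - η)p.
    have e1 : 3 / δ * (δ / √(x r ^ 2 + δ ^ 2)) = 3 / √(x r ^ 2 + δ ^ 2) := by
      have := hq r
      field_simp
    have t1 : δ / (x r ^ 2 + δ ^ 2) ≤ 1 / √(x r ^ 2 + δ ^ 2) := by
      rw [div_le_div_iff₀ (hD r) (hq r)]
      nth_rw 2 [← hq2 r]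
      have := mul_le_mul_of_nonneg_right (hqδ r) (hq r).le
      nlinarith
    have t2 : δ / √(x r ^ 2 + δ ^ 2) ≤ 1 / √(x r ^ 2 + δ ^ 2) := by
      have := hq r
      gcongr
    rw [e1]
    calc _ ≤ |δ * (η r * (1 - x r ^ 2) * (δ ^ 2 - x r ^ 2) / (x r ^ 2 + δ ^ 2)) / (x r ^ 2 + δ ^ 2)|
          + |2 * (1 - η r) * (δ * (x r * η r) / (x r ^ 2 + δ ^ 2))| := by
          rw [sub_eq_add_neg]; exact (abs_add_le _ _).trans_eq (by rw [abs_neg, abs_neg])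
      _ ≤ δ / (x r ^ 2 + δ ^ 2) + 2 * (δ / √(x r ^ 2 + δ ^ 2)) := by
          refine add_le_add ?_ ?_
          · rw [abs_div, abs_of_pos (hD r), abs_mul, abs_of_pos hδ]
            have := hD r
            gcongr
            exact mul_le_of_le_one_right hδ.le b1
          · rw [abs_mul, abs_of_nonneg (by linarith [hη1 r] : 0 ≤ 2 * (1 - η r))]
            exact mul_le_mul (by linarith [hη0 r]) ((hp r).trans (hxq r)) (abs_nonneg _) (by norm_num)
      _ ≤ 1 / √(x r ^ 2 + δ ^ 2) + 2 * (1 / √(x r ^ 2 + δ ^ 2)) := by gcongr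
      _ = _ := by ring
  · intro r
    have := hD r
    rw [div_pow, hq2 r, ← mul_div_assoc, mul_left_comm, hxη r]
    field_simp
    ring
  · intro r
    rw [abs_mul, abs_of_pos hδ, mul_comm]
    gcongr
    rw [abs_le]
    constructor <;>
      linarith [Real.arctan_lt_pi_div_two (x r / δ), Real.neg_pi_div_two_lt_arctan (x r / δ),
        Real.pi_lt_four]
  · intro r hr
    have hd := (((dx r hr).div_const δ).arctan).const_mul δ
    have he : -(r * deriv (fun r => δ * Real.arctan (x r / δ)) r)
        = δ ^ 2 / (x r ^ 2 + δ ^ 2) * (1 - x r ^ 2) := by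
      rw [hd.deriv]
      have := hD r
      have h2 : 0 < 1 + (x r / δ) ^ 2 := by positivity
      field_simp
      ring
    rw [he, div_pow, hq2 r]
    -- Since -rA' = σ²(1 - x²), the defect from σ² is σ²x² ≤ δ².
    have h1 : δ ^ 2 / (x r ^ 2 + δ ^ 2) * x r ^ 2 ≤ δ ^ 2 := by
      rw [div_mul_eq_mul_div, div_le_iff₀ (hD r)]
      nlinarith [sq_nonneg δ, sq_nonneg (δ ^ 2)]
    linarith

end Multiplier

/-! ### Hardy inequalities and the mass in the layer -/

section Hardy

variable {R : ℝ}

lemma l2norm_le_mul {f g : ℝ → ℂ} (hf : MemLp f 2 (volume.restrict (Ioo 1 R)))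
    (hg : MemLp g 2 (volume.restrict (Ioo 1 R))) {a : ℝ} (ha : 0 ≤ a)
    (H : ∀ r ∈ Ioo 1 R, ‖f r‖ ≤ a * ‖g r‖) : l2norm R f ≤ a * l2norm R g := by
  have := l2norm_le_add hf hg hg ha le_rfl (fun r hr => by linarith [H r hr])
  linarith

/-- A weighted Hardy identity: for `A ∈ C¹` and a test function `f`, the integral of
`(A |f|² / r)'` vanishes, so that `∫ (-r A') |f|² / r²` is controlled by `sup |A|`. -/
lemma integral_weight_le (hR : 1 < R) {f : ℝ → ℂ} (hf : IsTest R f) {A : ℝ → ℝ}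
    (hA : ContDiff ℝ 1 A) {a : ℝ} (ha : ∀ r, |A r| ≤ a) :
    ∫ r in Ioo 1 R, -(r * deriv A r) * ‖f r / r‖ ^ 2 + A r * ‖f r / r‖ ^ 2
      ≤ 2 * a * (l2norm R (fun r => f r / r) * l2norm R (dr R f)) := by
  have hfc := hf.contDiffOn.continuousOn
  have hdc := continuousOn_dr hR hf.contDiffOn
  have hrc := continuousOn_div_r hfc
  have ha0 : 0 ≤ a := (abs_nonneg _).trans (ha 0)
  have hAc : Continuous A := hA.continuous
  have hA'c : Continuous (deriv A) := hA.continuous_deriv le_rfl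
  have hr0 : ∀ r ∈ Icc 1 R, r ≠ 0 := fun r hr => by linarith [hr.1]
  have cinv : ContinuousOn (fun r : ℝ => r⁻¹) (Icc 1 R) := continuousOn_inv₀.mono hr0
  have c1 : ContinuousOn (fun r => -(r * deriv A r) * ‖f r / r‖ ^ 2 + A r * ‖f r / r‖ ^ 2)
      (Icc 1 R) := by
    exact ((continuous_id.mul hA'c).neg.continuousOn.mul (hrc.norm.pow 2)).add
      (hAc.continuousOn.mul (hrc.norm.pow 2))
  have c2 : ContinuousOn (fun r => 2 * A r * (inner ℝ (f r) (dr R f r) * r⁻¹)) (Icc 1 R) :=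
    (continuous_const.mul hAc).continuousOn.mul ((hfc.inner hdc).mul cinv)
  have hder : ∀ r ∈ Ioo 1 R, HasDerivAt (fun r => A r * ‖f r‖ ^ 2 * r⁻¹)
      (2 * A r * (inner ℝ (f r) (dr R f r) * r⁻¹)
        - (-(r * deriv A r) * ‖f r / r‖ ^ 2 + A r * ‖f r / r‖ ^ 2)) r := fun r hr => by
    have hr' : r ≠ 0 := hr0 r (Ioo_subset_Icc_self hr)
    have h := (((hA.differentiable one_ne_zero r).hasDerivAt).mul
      (hasDerivAt_dr hf.contDiffOn hr).norm_sq).mul (hasDerivAt_inv hr')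
    convert! h using 1
    simp only [norm_div, Complex.norm_real, Real.norm_eq_abs, div_pow, sq_abs, Pi.mul_apply]
    field_simp
    ring
  have hftc := intervalIntegral.integral_eq_sub_of_hasDerivAt_of_le hR.le
    (f := fun r => A r * ‖f r‖ ^ 2 * r⁻¹)
    ((hAc.continuousOn.mul (hfc.norm.pow 2)).mul cinv) hder
    ((c2.sub c1).intervalIntegrable_of_Icc hR.le)
  rw [intervalIntegral.integral_of_le hR.le, integral_Ioc_eq_integral_Ioo,
    integral_sub (integrable_of_continuousOn c2) (integrable_of_continuousOn c1)] at hftc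
  simp only [hf.left, hf.right, norm_zero, ne_eq, OfNat.ofNat_ne_zero, not_false_eq_true,
    zero_pow, mul_zero, zero_mul, sub_zero] at hftc
  rw [← sub_eq_zero.1 hftc]
  calc ∫ r in Ioo 1 R, 2 * A r * (inner ℝ (f r) (dr R f r) * r⁻¹)
      ≤ ∫ r in Ioo 1 R, 2 * a * (‖f r / r‖ * ‖dr R f r‖) := by
        refine setIntegral_mono_on (integrable_of_continuousOn c2)
          (integrable_of_continuousOn (continuousOn_const.mul (hrc.norm.mul hdc.norm)))
          measurableSet_Ioo fun r hr => ?_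
        have hr' : 0 < r := by linarith [hr.1]
        have h1 : |inner ℝ (f r) (dr R f r) * r⁻¹| ≤ ‖f r / r‖ * ‖dr R f r‖ := by
          rw [abs_mul, abs_of_pos (inv_pos.2 hr'), norm_div, Complex.norm_real,
            Real.norm_of_nonneg hr'.le, div_mul_eq_mul_div, ← div_eq_mul_inv]
          gcongr
          exact abs_real_inner_le_norm _ _
        calc _ ≤ |2 * A r * (inner ℝ (f r) (dr R f r) * r⁻¹)| := le_abs_self _
          _ = 2 * |A r| * |inner ℝ (f r) (dr R f r) * r⁻¹| := by
            rw [abs_mul, abs_mul, abs_two]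
          _ ≤ _ := by gcongr; exact ha r
    _ = 2 * a * ∫ r in Ioo 1 R, ‖f r / r‖ * ‖dr R f r‖ := integral_const_mul _ _
    _ ≤ _ := by
        gcongr
        exact integral_norm_mul_norm_le (memLp_of_continuousOn hrc) (memLp_of_continuousOn hdc)

/-- Hardy's inequality. -/
lemma l2norm_div_r_le (hR : 1 < R) {f : ℝ → ℂ} (hf : IsTest R f) :
    l2norm R (fun r => f r / r) ≤ 2 * l2norm R (dr R f) := by
  have h := integral_weight_le hR hf (A := fun _ => 1) contDiff_const (a := 1) (by simp)
  simp only [deriv_const, mul_zero, neg_zero, zero_mul, one_mul, zero_add] at h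
  rw [← l2norm_sq R (fun r => f r / r)] at h
  rcases (l2norm_nonneg R (fun r => f r / r)).eq_or_lt with h0 | h0
  · rw [← h0]; exact mul_nonneg zero_le_two (l2norm_nonneg _ _)
  · refine le_of_mul_le_mul_left ?_ h0
    linarith

/-- From A ≥ -2δ and δ² ≤ δ follows σ² ≤ -rA' + A + 3δ. The first two terms cost 4δ‖f/r‖‖f'‖ by the
weighted identity with sup|A| ≤ 2δ; the last costs 6δ‖f/r‖‖f'‖ by Hardy's inequality. -/
lemma l2norm_layer_sq_le (hR : 1 < R) {f : ℝ → ℂ} (hf : IsTest R f) {lam δ : ℝ} (hδ : 0 < δ)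
    (hδ1 : δ ≤ 1) {p A σ : ℝ → ℝ} (hm : IsMultiplier lam δ p A σ) :
    l2norm R (fun r => (σ r : ℂ) * (f r / r)) ^ 2
      ≤ 10 * δ * (l2norm R (fun r => f r / r) * l2norm R (dr R f)) := by
  have hrc := continuousOn_div_r hf.contDiffOn.continuousOn
  have hH := l2norm_div_r_le hR hf
  have h := integral_weight_le hR hf hm.contDiff_A hm.abs_A_le
  have hA'c : Continuous (deriv A) := hm.contDiff_A.continuous_deriv le_rfl
  have c0 : ContinuousOn (fun r => ‖f r / r‖ ^ 2) (Icc 1 R) := hrc.norm.pow 2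
  have c1 : ContinuousOn (fun r => -(r * deriv A r) * ‖f r / r‖ ^ 2 + A r * ‖f r / r‖ ^ 2)
      (Icc 1 R) := ((continuous_id.mul hA'c).neg.continuousOn.mul c0).add
      (hm.contDiff_A.continuous.continuousOn.mul c0)
  have cσ : ContinuousOn (fun r => ‖(σ r : ℂ) * (f r / r)‖ ^ 2) (Icc 1 R) :=
    (((Complex.continuous_ofReal.comp hm.continuous_σ).continuousOn.mul hrc).norm.pow 2)
  have hmono : l2norm R (fun r => (σ r : ℂ) * (f r / r)) ^ 2
      ≤ (∫ r in Ioo 1 R, -(r * deriv A r) * ‖f r / r‖ ^ 2 + A r * ‖f r / r‖ ^ 2)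
        + 3 * δ * l2norm R (fun r => f r / r) ^ 2 := by
    rw [l2norm_sq, l2norm_sq, ← integral_const_mul, ← integral_add (integrable_of_continuousOn c1)
      ((integrable_of_continuousOn c0).const_mul _)]
    refine setIntegral_mono_on (integrable_of_continuousOn cσ) ((integrable_of_continuousOn c1).add
      ((integrable_of_continuousOn c0).const_mul _)) measurableSet_Ioo fun r hr => ?_
    have hr' : 0 < r := by linarith [hr.1]
    rw [norm_mul, mul_pow, Complex.norm_real, Real.norm_eq_abs, sq_abs]
    have h1 := hm.σ_sq_le r hr'
    have h2 := (abs_le.1 (hm.abs_A_le r)).1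
    have h3 : σ r ^ 2 ≤ -(r * deriv A r) + A r + 3 * δ := by nlinarith
    have := mul_le_mul_of_nonneg_right h3 (sq_nonneg ‖f r / r‖)
    linarith
  have h5 := mul_le_mul_of_nonneg_left hH (l2norm_nonneg R (fun r => f r / r))
  have h6 := mul_le_mul_of_nonneg_left h5 (by positivity : 0 ≤ 3 * δ)
  nlinarith

end Hardy

/-! ### The weak form of the equation -/

section WeakForm

variable {R : ℝ}

lemma l2inner_congr {f g f₁ g₁ : ℝ → ℂ}
    (H : ∀ r ∈ Ioo 1 R, f r * conj (g r) = f₁ r * conj (g₁ r)) :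
    l2inner R f g = l2inner R f₁ g₁ :=
  setIntegral_congr_fun measurableSet_Ioo H

lemma l2inner_eq_add {f g f₁ g₁ f₂ g₂ : ℝ → ℂ} {a₁ a₂ : ℂ}
    (hf₁ : MemLp f₁ 2 (volume.restrict (Ioo 1 R))) (hg₁ : MemLp g₁ 2 (volume.restrict (Ioo 1 R)))
    (hf₂ : MemLp f₂ 2 (volume.restrict (Ioo 1 R))) (hg₂ : MemLp g₂ 2 (volume.restrict (Ioo 1 R)))
    (H : ∀ r ∈ Ioo 1 R, f r * conj (g r)
      = a₁ * (f₁ r * conj (g₁ r)) + a₂ * (f₂ r * conj (g₂ r))) :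
    l2inner R f g = a₁ * l2inner R f₁ g₁ + a₂ * l2inner R f₂ g₂ := by
  rw [l2inner, setIntegral_congr_fun measurableSet_Ioo H,
    integral_add ((integrable_mul_conj hf₁ hg₁).const_mul _)
      ((integrable_mul_conj hf₂ hg₂).const_mul _), integral_const_mul, integral_const_mul]
  rfl

lemma l2inner_eq_ofReal {f g : ℝ → ℂ} {u : ℝ → ℝ}
    (H : ∀ r ∈ Ioo 1 R, f r * conj (g r) = (u r : ℂ)) :
    l2inner R f g = ((∫ r in Ioo 1 R, u r : ℝ) : ℂ) := by
  rw [l2inner, setIntegral_congr_fun measurableSet_Ioo H]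
  exact integral_ofReal

lemma l2inner_self (R : ℝ) (f : ℝ → ℂ) : l2inner R f f = ((l2norm R f ^ 2 : ℝ) : ℂ) := by
  rw [l2norm_sq]
  exact l2inner_eq_ofReal fun r _ => by rw [Complex.mul_conj']; push_cast; rfl

lemma continuousOn_div_sq {f : ℝ → ℂ} (hf : ContinuousOn f (Icc 1 R)) (c : ℂ) :
    ContinuousOn (fun r : ℝ => c / (r : ℂ) ^ 2 * f r) (Icc 1 R) := by
  refine (continuousOn_const.div (Complex.continuous_ofReal.continuousOn.pow 2)
    fun r hr => ?_).mul hf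
  have : (0 : ℝ) < r := by linarith [hr.1]
  exact pow_ne_zero 2 (by exact_mod_cast this.ne')

lemma memLp_lapK {f : ℝ → ℂ} (hf : MemH2 R f) (k : ℤ) :
    MemLp (lapK R k f) 2 (volume.restrict (Ioo 1 R)) :=
  hf.dr_memH1.dr_memLp.sub
    (memLp_of_continuousOn (continuousOn_div_sq hf.contDiffOn.continuousOn _))

lemma memLp_resolventF {w : ℝ → ℂ} (hw : MemH2 R w) (ν B lam : ℝ) (k : ℤ) :
    MemLp (resolventF ν B R lam k w) 2 (volume.restrict (Ioo 1 R)) :=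
  (((memLp_lapK hw k).const_mul _).add
    (memLp_of_continuousOn (continuousOn_div_sq hw.contDiffOn.continuousOn _))).sub
    ((memLp_of_continuousOn hw.contDiffOn.continuousOn).const_mul _)

lemma l2inner_lapK (hR : 1 < R) {f g : ℝ → ℂ} (hf : MemH2 R f) (hg : IsTest R g) (k : ℤ) :
    l2inner R (lapK R k f) g = -l2inner R (dr R f) (dr R g)
      - (((k : ℝ) ^ 2 - 1 / 4 : ℝ) : ℂ) * l2inner R (fun r => f r / r) (fun r => g r / r) := by
  rw [← l2inner_dr_eq_neg hR hf.dr_memH1 hg]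
  rw [l2inner_eq_add (a₁ := 1) (a₂ := -(((k : ℝ) ^ 2 - 1 / 4 : ℝ) : ℂ)) hf.dr_memH1.dr_memLp
    (memLp_of_continuousOn hg.contDiffOn.continuousOn)
    (memLp_of_continuousOn (continuousOn_div_r hf.contDiffOn.continuousOn))
    (memLp_of_continuousOn (continuousOn_div_r hg.contDiffOn.continuousOn))]
  · ring
  · intro r hr
    have h0 : (r : ℂ) ≠ 0 := by
      have : (0 : ℝ) < r := by linarith [hr.1]
      exact_mod_cast this.ne'
    simp only [lapK, map_div₀, Complex.conj_ofReal]
    push_cast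
    field_simp
    ring

lemma continuousOn_coeff_mul {f : ℝ → ℂ} (hf : ContinuousOn f (Icc 1 R)) (lam : ℝ) :
    ContinuousOn (fun r : ℝ => ((1 / r ^ 2 - lam : ℝ) : ℂ) * f r) (Icc 1 R) := by
  refine (Complex.continuous_ofReal.comp_continuousOn
    ((continuousOn_const.div (continuousOn_id.pow 2) fun r hr => ?_).sub continuousOn_const)).mul hf
  have : (0 : ℝ) < r := by linarith [hr.1]
  exact pow_ne_zero 2 this.ne'

/-- The weak form of the shifted resolvent equation. -/
lemma l2inner_resolventF (hR : 1 < R) {w g : ℝ → ℂ} (hw : MemH2 R w) (hg : IsTest R g)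
    (ν B lam s : ℝ) (k : ℤ) :
    l2inner R (fun r => resolventF ν B R lam k w r - (s : ℂ) * w r) g
      = ν * (l2inner R (dr R w) (dr R g)
          + (((k : ℝ) ^ 2 - 1 / 4 : ℝ) : ℂ) * l2inner R (fun r => w r / r) (fun r => g r / r))
        + Complex.I * ((k * B : ℝ) : ℂ)
          * l2inner R (fun r : ℝ => ((1 / r ^ 2 - lam : ℝ) : ℂ) * w r) g
        - s * l2inner R w g := by
  have hwc := hw.contDiffOn.continuousOn
  have hgL := memLp_of_continuousOn hg.contDiffOn.continuousOn
  have h1 := l2inner_eq_add (f := fun r => resolventF ν B R lam k w r) (g := g)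
    (a₁ := -(ν : ℂ)) (a₂ := Complex.I * ((k * B : ℝ) : ℂ)) (memLp_lapK hw k) hgL
    (memLp_of_continuousOn (continuousOn_coeff_mul hwc lam)) hgL (fun r hr => by
      simp only [resolventF, opL]
      push_cast
      ring)
  have h2 := l2inner_eq_add (f := fun r => resolventF ν B R lam k w r - (s : ℂ) * w r) (g := g)
    (a₁ := 1) (a₂ := -(s : ℂ)) (memLp_resolventF hw ν B lam k) hgL (memLp_of_continuousOn hwc) hgL
    (fun r _ => by ring)
  rw [h2]
  change 1 * l2inner R (fun r => resolventF ν B R lam k w r) g + _ = _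
  rw [h1, l2inner_lapK hR hw hg]
  ring

end WeakForm

/-! ### Energy and critical-layer estimates for w -/

section Estimates

variable {R : ℝ}

lemma l2norm_sq_le (hR : 1 < R) {w : ℝ → ℂ} (hw : ContinuousOn w (Icc 1 R)) :
    l2norm R w ^ 2 ≤ R ^ 2 * l2norm R (fun r => w r / r) ^ 2 := by
  rw [← mul_pow]
  refine pow_le_pow_left₀ (l2norm_nonneg _ _) (l2norm_le_mul (memLp_of_continuousOn hw)
    (memLp_of_continuousOn (continuousOn_div_r hw)) (by linarith) fun r hr => ?_) 2
  have hr' : 0 < r := by linarith [hr.1]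
  rw [norm_div, Complex.norm_real, Real.norm_of_nonneg hr'.le, ← mul_div_assoc, le_div_iff₀ hr',
    mul_comm]
  exact mul_le_mul_of_nonneg_right hr.2.le (norm_nonneg _)

/-- The real part of the resolvent equation tested with `w`. -/
lemma energy_le (hR : 1 < R) {w : ℝ → ℂ} (hw : MemDomain R w) (ν B lam : ℝ) {s : ℝ} (hs : 0 ≤ s)
    (k : ℤ) :
    ν * (l2norm R (dr R w) ^ 2 + ((k : ℝ) ^ 2 - 1 / 4) * l2norm R (fun r => w r / r) ^ 2)
      ≤ ‖l2inner R (fun r => resolventF ν B R lam k w r - (s : ℂ) * w r) w‖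
        + s * R ^ 2 * l2norm R (fun r => w r / r) ^ 2 := by
  have h := l2inner_resolventF hR hw.memH2 hw.isTest ν B lam s k
  rw [l2inner_self, l2inner_self, l2inner_self, l2inner_eq_ofReal (R := R)
    (f := fun r : ℝ => ((1 / r ^ 2 - lam : ℝ) : ℂ) * w r) (g := w)
    (u := fun r => (1 / r ^ 2 - lam) * ‖w r‖ ^ 2) (fun r _ => by
      rw [mul_assoc, Complex.mul_conj']; push_cast; rfl)] at h
  -- The potential term is i times a real number and disappears; the shift survives as -s‖w‖²,
  -- bounded through ‖w‖ ≤ R‖w/r‖.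
  have hre := congrArg Complex.re h
  simp only [Complex.sub_re, Complex.add_re, Complex.ofReal_re,
    Complex.mul_re, Complex.I_re, Complex.I_im, Complex.ofReal_im, Complex.mul_im] at hre
  have h1 := Complex.re_le_norm
    (l2inner R (fun r => resolventF ν B R lam k w r - (s : ℂ) * w r) w)
  have h2 := mul_le_mul_of_nonneg_left (l2norm_sq_le hR hw.memH2.contDiffOn.continuousOn) hs
  simp only [zero_mul, mul_zero, sub_zero, add_zero, one_mul] at hre
  linarith

variable {lam δ : ℝ} {p A σ : ℝ → ℝ}

lemma IsMultiplier.continuousOn_layer (hm : IsMultiplier lam δ p A σ) {f : ℝ → ℂ}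
    (hf : ContinuousOn f (Icc 1 R)) :
    ContinuousOn (fun r => (σ r : ℂ) * (f r / r)) (Icc 1 R) :=
  (Complex.continuous_ofReal.comp hm.continuous_σ).continuousOn.mul (continuousOn_div_r hf)

lemma IsMultiplier.l2norm_layer_le (hm : IsMultiplier lam δ p A σ) {f : ℝ → ℂ}
    (hf : ContinuousOn f (Icc 1 R)) :
    l2norm R (fun r => (σ r : ℂ) * (f r / r)) ≤ l2norm R (fun r => f r / r) := by
  have := l2norm_le_mul (memLp_of_continuousOn (hm.continuousOn_layer hf))
    (memLp_of_continuousOn (continuousOn_div_r hf)) zero_le_one (fun r hr => by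
      rw [norm_mul, Complex.norm_real, Real.norm_of_nonneg (hm.σ_nonneg r)]
      exact mul_le_mul_of_nonneg_right (hm.σ_le_one r) (norm_nonneg _))
  linarith

lemma IsMultiplier.norm_deriv_mul_le (hm : IsMultiplier lam δ p A σ) (f : ℝ → ℂ) {r : ℝ}
    (hr : 0 < r) :
    ‖((deriv p r : ℝ) : ℂ) * f r‖ ≤ 3 / δ * ‖(σ r : ℂ) * (f r / r)‖ := by
  have h := hm.abs_deriv_p_le r hr
  rw [abs_mul, abs_of_pos hr] at h
  rw [norm_mul, norm_mul, norm_div, Complex.norm_real, Complex.norm_real, Complex.norm_real,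
    Real.norm_of_nonneg (hm.σ_nonneg r), Real.norm_of_nonneg hr.le, Real.norm_eq_abs]
  calc |deriv p r| * ‖f r‖ = (r * |deriv p r|) * (‖f r‖ / r) := by field_simp
    _ ≤ (3 / δ * σ r) * (‖f r‖ / r) := by gcongr
    _ = _ := by ring

/-- The imaginary part of the resolvent equation tested with `p w`, for a multiplier `p`
adapted to the critical layer. -/
lemma layer_estimate (hR : 1 < R) {w : ℝ → ℂ} (hw : MemDomain R w) {ν : ℝ} (hν : 0 ≤ ν)
    (B s : ℝ) (k : ℤ) (hδ : 0 < δ) (hδ1 : δ ≤ 1) (hm : IsMultiplier lam δ p A σ) :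
    |(k * B : ℝ)| * δ * l2norm R (fun r => w r / r) ^ 2
      ≤ ‖l2inner R (fun r => resolventF ν B R lam k w r - (s : ℂ) * w r)
            (fun r => (p r : ℂ) * w r)‖
        + ν * (3 / δ) * (l2norm R (fun r => w r / r) * l2norm R (dr R w))
        + |(k * B : ℝ)| * δ * (10 * δ * (l2norm R (fun r => w r / r) * l2norm R (dr R w))) := by
  have hwc := hw.memH2.contDiffOn.continuousOn
  have hdc := continuousOn_dr hR hw.memH2.contDiffOn
  have hrc := continuousOn_div_r hwc
  have hσc := hm.continuousOn_layer hwc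
  have hp'c : ContinuousOn (fun r => ((deriv p r : ℝ) : ℂ) * w r) (Icc 1 R) :=
    (Complex.continuous_ofReal.comp (hm.contDiff_p.continuous_deriv le_rfl)).continuousOn.mul hwc
  have hpdc : ContinuousOn (fun r => (p r : ℂ) * dr R w r) (Icc 1 R) :=
    (Complex.continuous_ofReal.comp hm.contDiff_p.continuous).continuousOn.mul hdc
  have h := l2inner_resolventF hR hw.memH2 (hw.isTest.mul_ofReal hm.contDiff_p) ν B lam s k
  have e1 := l2inner_eq_add (f := dr R w) (g := dr R fun r => (p r : ℂ) * w r) (a₁ := 1) (a₂ := 1)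
    (memLp_of_continuousOn hdc) (memLp_of_continuousOn hpdc)
    (memLp_of_continuousOn hdc) (memLp_of_continuousOn hp'c) (fun r hr => by
      rw [dr_mul_ofReal hw.memH2.contDiffOn hm.contDiff_p hr, map_add]; ring)
  have e2 : l2inner R (dr R w) (fun r => (p r : ℂ) * dr R w r)
      = ((∫ r in Ioo 1 R, p r * ‖dr R w r‖ ^ 2 : ℝ) : ℂ) :=
    l2inner_eq_ofReal fun r _ => by
      rw [map_mul, Complex.conj_ofReal, mul_left_comm, Complex.mul_conj']; push_cast; rfl
  have e3 : l2inner R (fun r => w r / r) (fun r => (p r : ℂ) * w r / r)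
      = ((∫ r in Ioo 1 R, p r * ‖w r / r‖ ^ 2 : ℝ) : ℂ) :=
    l2inner_eq_ofReal fun r _ => by
      rw [mul_div_assoc, map_mul, Complex.conj_ofReal, mul_left_comm, Complex.mul_conj']
      push_cast; rfl
  have e4 : l2inner R w (fun r => (p r : ℂ) * w r)
      = ((∫ r in Ioo 1 R, p r * ‖w r‖ ^ 2 : ℝ) : ℂ) :=
    l2inner_eq_ofReal fun r _ => by
      rw [map_mul, Complex.conj_ofReal, mul_left_comm, Complex.mul_conj']; push_cast; rfl
  -- The identity (1/r² - λ)p = δ(1 - σ²)/r² turns the potential term into full mass minus layer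
  -- mass.
  have e5 := l2inner_eq_add (f := fun r : ℝ => ((1 / r ^ 2 - lam : ℝ) : ℂ) * w r)
    (g := fun r => (p r : ℂ) * w r) (a₁ := (δ : ℂ)) (a₂ := -(δ : ℂ))
    (memLp_of_continuousOn hrc) (memLp_of_continuousOn hrc)
    (memLp_of_continuousOn hσc) (memLp_of_continuousOn hσc) (fun r hr => by
      have hr' : r ≠ 0 := by linarith [hr.1]
      have hr'' : (r : ℂ) ≠ 0 := by exact_mod_cast hr'
      have hc : ((1 / r ^ 2 - lam : ℝ) : ℂ) * p r = δ * (1 - (σ r : ℂ) ^ 2) / (r : ℂ) ^ 2 := by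
        rw [eq_div_iff (pow_ne_zero 2 hr'')]
        have h1 := hm.mul_p r
        have h2 : (1 / r ^ 2 - lam) * p r * r ^ 2 = δ * (1 - σ r ^ 2) := by
          rw [← h1]; field_simp
        exact_mod_cast h2
      rw [map_mul, Complex.conj_ofReal, map_mul, Complex.conj_ofReal, map_div₀,
        Complex.conj_ofReal]
      calc ((1 / r ^ 2 - lam : ℝ) : ℂ) * w r * (p r * conj (w r))
          = (((1 / r ^ 2 - lam : ℝ) : ℂ) * p r) * (w r * conj (w r)) := by ring
        _ = _ := by rw [hc]; field_simp; ring)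
  rw [l2inner_self, l2inner_self] at e5
  rw [e1, e2, e3, e4, e5] at h
  -- As p is real, p|w'|², p|w/r|² and the shift p|w|² contribute nothing to the imaginary part.
  -- Only the commutator p'w and the potential remain.
  have him := congrArg Complex.im h
  set X := l2norm R (fun r => w r / r)
  set Y := l2norm R (dr R w)
  set S := l2norm R (fun r => (σ r : ℂ) * (w r / r)) with hS
  set z := l2inner R (dr R w) (fun r => ((deriv p r : ℝ) : ℂ) * w r) with hz
  set T := l2inner R (fun r => resolventF ν B R lam k w r - (s : ℂ) * w r)
    (fun r => (p r : ℂ) * w r)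
  have hzle : ‖z‖ ≤ 3 / δ * (X * Y) := by
    refine (norm_l2inner_le (memLp_of_continuousOn hdc) (memLp_of_continuousOn hp'c)).trans ?_
    have h1 : l2norm R (fun r => ((deriv p r : ℝ) : ℂ) * w r) ≤ 3 / δ * S :=
      l2norm_le_mul (memLp_of_continuousOn hp'c) (memLp_of_continuousOn hσc) (by positivity)
        fun r hr => hm.norm_deriv_mul_le w (by linarith [hr.1])
    have h2 : S ≤ X := hm.l2norm_layer_le hwc
    calc Y * l2norm R (fun r => ((deriv p r : ℝ) : ℂ) * w r) ≤ Y * (3 / δ * X) := by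
          refine mul_le_mul_of_nonneg_left (h1.trans ?_) (l2norm_nonneg _ _)
          gcongr
      _ = _ := by ring
  have hSle : S ^ 2 ≤ 10 * δ * (X * Y) := l2norm_layer_sq_le hR hw.isTest hδ hδ1 hm
  have him' : (k * B) * (δ * (X ^ 2 - S ^ 2)) = T.im - ν * z.im := by
    rw [him]
    have : ((δ : ℂ) * ((X ^ 2 : ℝ) : ℂ) + -(δ : ℂ) * ((S ^ 2 : ℝ) : ℂ))
        = ((δ * (X ^ 2 - S ^ 2) : ℝ) : ℂ) := by push_cast; ring
    rw [this]
    simp only [Complex.sub_im, Complex.add_im, Complex.add_re, Complex.ofReal_re, Complex.mul_re,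
      Complex.I_re, Complex.I_im, Complex.ofReal_im, Complex.mul_im, one_mul]
    ring
  have habs : |(k * B : ℝ)| * (δ * (X ^ 2 - S ^ 2)) ≤ ‖T‖ + ν * ‖z‖ := by
    calc |(k * B : ℝ)| * (δ * (X ^ 2 - S ^ 2)) ≤ |(k * B : ℝ)| * |δ * (X ^ 2 - S ^ 2)| := by
          gcongr; exact le_abs_self _
      _ = |T.im - ν * z.im| := by rw [← abs_mul, him']
      _ ≤ |T.im| + |ν * z.im| := abs_sub _ _
      _ ≤ _ := by
        rw [abs_mul, abs_of_nonneg hν]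
        gcongr
        · exact Complex.abs_im_le_norm _
        · exact Complex.abs_im_le_norm _
  have h3 := mul_le_mul_of_nonneg_left hzle hν
  have h4 := mul_le_mul_of_nonneg_left hSle (by positivity : 0 ≤ |(k * B : ℝ)| * δ)
  linarith

lemma IsMultiplier.l2norm_mul_div_r_le (hm : IsMultiplier lam δ p A σ) {f : ℝ → ℂ}
    (hf : ContinuousOn f (Icc 1 R)) :
    l2norm R (fun r => (p r : ℂ) * f r / r) ≤ l2norm R (fun r => (σ r : ℂ) * (f r / r)) := by
  have hpc : ContinuousOn (fun r => (p r : ℂ) * f r) (Icc 1 R) :=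
    (Complex.continuous_ofReal.comp hm.contDiff_p.continuous).continuousOn.mul hf
  have := l2norm_le_mul (memLp_of_continuousOn (continuousOn_div_r hpc))
    (memLp_of_continuousOn (hm.continuousOn_layer hf)) zero_le_one (fun r hr => by
      rw [mul_div_assoc, norm_mul, norm_mul, Complex.norm_real, Complex.norm_real,
        Real.norm_of_nonneg (hm.σ_nonneg r), one_mul]
      exact mul_le_mul_of_nonneg_right (hm.abs_p_le r) (norm_nonneg _))
  linarith

lemma IsMultiplier.l2norm_dr_mul_le (hm : IsMultiplier lam δ p A σ) (hR : 1 < R) (hδ : 0 < δ)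
    {f : ℝ → ℂ} (hf : IsTest R f) :
    l2norm R (dr R fun r => (p r : ℂ) * f r)
      ≤ l2norm R (dr R f) + 3 / δ * l2norm R (fun r => (σ r : ℂ) * (f r / r)) := by
  have := l2norm_le_add
    (memLp_of_continuousOn (continuousOn_dr hR (hf.mul_ofReal hm.contDiff_p).contDiffOn))
    (memLp_of_continuousOn (continuousOn_dr hR hf.contDiffOn))
    (memLp_of_continuousOn (hm.continuousOn_layer hf.contDiffOn.continuousOn)) zero_le_one
    (by positivity : 0 ≤ 3 / δ) (fun r hr => by
      have hr' : 0 < r := by linarith [hr.1]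
      rw [dr_mul_ofReal hf.contDiffOn hm.contDiff_p hr]
      refine (norm_add_le _ _).trans ?_
      rw [add_comm]
      refine add_le_add ?_ (hm.norm_deriv_mul_le f hr')
      rw [norm_mul, Complex.norm_real]
      exact mul_le_mul_of_nonneg_right ((hm.abs_p_le r).trans (hm.σ_le_one r)) (norm_nonneg _))
  linarith

end Estimates

/-! ### Estimates for the stream function -/

section Stream

variable {R : ℝ}

lemma continuousOn_r_mul {f : ℝ → ℂ} (hf : ContinuousOn f (Icc 1 R)) :
    ContinuousOn (fun r : ℝ => (r : ℂ) * f r) (Icc 1 R) :=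
  Complex.continuous_ofReal.continuousOn.mul hf

lemma norm_r_mul_le {f : ℝ → ℂ} {r : ℝ} (hr : r ∈ Ioo 1 R) :
    ‖(r : ℂ) * f r‖ ≤ R ^ 2 * ‖f r / r‖ := by
  have hr' : 0 < r := by linarith [hr.1]
  rw [norm_mul, norm_div, Complex.norm_real, Real.norm_of_nonneg hr'.le]
  calc r * ‖f r‖ = r ^ 2 * (‖f r‖ / r) := by field_simp
    _ ≤ _ := by gcongr; exact hr.2.le

lemma l2norm_r_mul_le {f : ℝ → ℂ} (hf : ContinuousOn f (Icc 1 R)) :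
    l2norm R (fun r : ℝ => (r : ℂ) * f r) ≤ R ^ 2 * l2norm R (fun r => f r / r) :=
  l2norm_le_mul (memLp_of_continuousOn (continuousOn_r_mul hf))
    (memLp_of_continuousOn (continuousOn_div_r hf)) (sq_nonneg R) fun _ hr => norm_r_mul_le hr

/-- Moves one factor r across the pairing and uses r ≤ R²/r. -/
lemma norm_l2inner_le_div_mul {f g : ℝ → ℂ}
    (hfr : MemLp (fun r => f r / r) 2 (volume.restrict (Ioo 1 R)))
    (hg : ContinuousOn g (Icc 1 R)) :
    ‖l2inner R f g‖ ≤ l2norm R (fun r => f r / r) * (R ^ 2 * l2norm R (fun r => g r / r)) := by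
  have e : l2inner R f g = l2inner R (fun r => f r / r) (fun r : ℝ => (r : ℂ) * g r) :=
    l2inner_congr fun r hr => by
      have h0 : (r : ℂ) ≠ 0 := by
        have : (0 : ℝ) < r := by linarith [hr.1]
        exact_mod_cast this.ne'
      rw [map_mul, Complex.conj_ofReal]
      field_simp
  rw [e]
  exact (norm_l2inner_le hfr (memLp_of_continuousOn (continuousOn_r_mul hg))).trans
    (mul_le_mul_of_nonneg_left (l2norm_r_mul_le hg) (l2norm_nonneg _ _))

lemma contDiff_sq_id : ContDiff ℝ 1 fun r : ℝ => r ^ 2 := contDiff_id.pow 2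

lemma l2norm_sq_mul_div_r_le {f : ℝ → ℂ} (hf : ContinuousOn f (Icc 1 R)) :
    l2norm R (fun r : ℝ => ((r ^ 2 : ℝ) : ℂ) * f r / r) ≤ R ^ 2 * l2norm R (fun r => f r / r) := by
  have hc : ContinuousOn (fun r : ℝ => ((r ^ 2 : ℝ) : ℂ) * f r) (Icc 1 R) :=
    (Complex.continuous_ofReal.comp contDiff_sq_id.continuous).continuousOn.mul hf
  refine l2norm_le_mul (memLp_of_continuousOn (continuousOn_div_r hc))
    (memLp_of_continuousOn (continuousOn_div_r hf)) (sq_nonneg R) fun r hr => ?_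
  have hr' : 0 < r := by linarith [hr.1]
  rw [mul_div_assoc, norm_mul, Complex.norm_real, Real.norm_of_nonneg (sq_nonneg r)]
  gcongr
  exact hr.2.le

lemma l2norm_dr_sq_mul_le (hR : 1 < R) {f : ℝ → ℂ} (hf : IsTest R f) :
    l2norm R (dr R fun r : ℝ => ((r ^ 2 : ℝ) : ℂ) * f r)
      ≤ R ^ 2 * (2 * l2norm R (fun r => f r / r) + l2norm R (dr R f)) := by
  have := l2norm_le_add
    (memLp_of_continuousOn (continuousOn_dr hR (hf.mul_ofReal contDiff_sq_id).contDiffOn))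
    (memLp_of_continuousOn (continuousOn_div_r hf.contDiffOn.continuousOn))
    (memLp_of_continuousOn (continuousOn_dr hR hf.contDiffOn))
    (by positivity : 0 ≤ 2 * R ^ 2) (sq_nonneg R) (fun r hr => by
      have hr' : 0 < r := by linarith [hr.1]
      rw [dr_mul_ofReal hf.contDiffOn contDiff_sq_id hr]
      refine (norm_add_le _ _).trans (add_le_add ?_ ?_)
      · have : deriv (fun r : ℝ => r ^ 2) r = 2 * r := by simp
        rw [this]
        have h := norm_r_mul_le (f := f) hr
        calc ‖((2 * r : ℝ) : ℂ) * f r‖ = 2 * ‖(r : ℂ) * f r‖ := by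
              push_cast; rw [mul_assoc, norm_mul]; simp
          _ ≤ _ := by linarith
      · rw [norm_mul, Complex.norm_real, Real.norm_of_nonneg (sq_nonneg r)]
        gcongr
        exact hr.2.le)
  linarith

lemma IsStream.isTest {k : ℤ} {w φ : ℝ → ℂ} (h : IsStream R k w φ) : IsTest R φ :=
  ⟨h.memH2.contDiffOn, h.left, h.right⟩

/-- The energy identity of the stream function. -/
lemma stream_energy (hR : 1 < R) {k : ℤ} {w φ : ℝ → ℂ} (h : IsStream R k w φ) :
    ((l2norm R (dr R φ) ^ 2 + ((k : ℝ) ^ 2 - 1 / 4) * l2norm R (fun r => φ r / r) ^ 2 : ℝ) : ℂ)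
      = -l2inner R w φ := by
  have e : l2inner R w φ = l2inner R (lapK R k φ) φ := by
    refine integral_congr_ae ?_
    filter_upwards [h.eqn] with r hr
    rw [hr]
  rw [e, l2inner_lapK hR h.memH2 h.isTest, l2inner_self, l2inner_self]
  push_cast
  ring

lemma stream_energy_le (hR : 1 < R) {k : ℤ} {w φ : ℝ → ℂ} (hw : MemDomain R w)
    (h : IsStream R k w φ) :
    l2norm R (dr R φ) ^ 2 + ((k : ℝ) ^ 2 - 1 / 4) * l2norm R (fun r => φ r / r) ^ 2
      ≤ l2norm R (fun r => w r / r) * (R ^ 2 * l2norm R (fun r => φ r / r)) := by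
  have hwc := hw.memH2.contDiffOn.continuousOn
  have e := congrArg norm (stream_energy hR h)
  rw [Complex.norm_real, norm_neg] at e
  calc _ ≤ _ := Real.le_norm_self _
    _ = _ := e
    _ ≤ _ := norm_l2inner_le_div_mul
      (memLp_of_continuousOn (continuousOn_div_r hwc)) h.isTest.contDiffOn.continuousOn

variable {lam δ : ℝ} {p A σ : ℝ → ℝ}

/-- The energy of the stream function is controlled by testing the resolvent equation with
`r ^ 2 p φ`, for a multiplier `p` adapted to the critical layer. -/
lemma stream_layer_estimate (hR : 1 < R) {k : ℤ} {w φ : ℝ → ℂ} (hw : MemDomain R w)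
    (h : IsStream R k w φ) (hk : 0 ≤ (k : ℝ) ^ 2 - 1 / 4) {ν s : ℝ} (hν : 0 ≤ ν) (hs : 0 ≤ s)
    (B : ℝ) (hδ : 0 < δ) (hδ1 : δ ≤ 1) (hm : IsMultiplier lam δ p A σ) :
    ∃ (g : ℝ → ℂ) (S : ℝ), IsTest R g ∧ 0 ≤ S ∧ S ≤ l2norm R (fun r => φ r / r)
      ∧ S ^ 2 ≤ 10 * δ * (l2norm R (fun r => φ r / r) * l2norm R (dr R φ))
      ∧ l2norm R (fun r => g r / r) ≤ R ^ 2 * S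
      ∧ l2norm R (dr R g) ≤ R ^ 2 * (l2norm R (dr R φ) + 5 / δ * S)
      ∧ |(k * B : ℝ)| * δ * (l2norm R (dr R φ) ^ 2
          + ((k : ℝ) ^ 2 - 1 / 4) * l2norm R (fun r => φ r / r) ^ 2)
        ≤ |(k * B : ℝ)| * δ * (l2norm R (fun r => w r / r) * (R ^ 2 * S))
          + ‖l2inner R (fun r => resolventF ν B R lam k w r - (s : ℂ) * w r) g‖
          + s * (l2norm R (fun r => w r / r) * (R ^ 2 * (R ^ 2 * S)))
          + ν * (l2norm R (dr R w) * (R ^ 2 * (l2norm R (dr R φ) + 5 / δ * S))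
            + ((k : ℝ) ^ 2 - 1 / 4) * (l2norm R (fun r => w r / r) * (R ^ 2 * S))) := by
  have hφ := h.isTest
  have hwc := hw.memH2.contDiffOn.continuousOn
  have hφc := hφ.contDiffOn.continuousOn
  have hwr := continuousOn_div_r hwc
  have hσc := hm.continuousOn_layer hφc
  have hpφ : IsTest R (fun r => (p r : ℂ) * φ r) := hφ.mul_ofReal hm.contDiff_p
  -- The weight r² cancels the 1/r² left by p, so that (1/r² - λ)g = δ(1 - σ²)φ reproduces the
  -- unweighted pairing ⟨w, φ⟩.
  set g : ℝ → ℂ := fun r => ((r ^ 2 : ℝ) : ℂ) * ((p r : ℂ) * φ r) with hg_def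
  have hg : IsTest R g := hpφ.mul_ofReal contDiff_sq_id
  set S := l2norm R (fun r => (σ r : ℂ) * (φ r / r)) with hS
  have hS0 : 0 ≤ S := l2norm_nonneg _ _
  have hg1 : l2norm R (fun r => g r / r) ≤ R ^ 2 * S :=
    (l2norm_sq_mul_div_r_le hpφ.contDiffOn.continuousOn).trans
      (mul_le_mul_of_nonneg_left (hm.l2norm_mul_div_r_le hφc) (sq_nonneg R))
  have hg2 : l2norm R (dr R g) ≤ R ^ 2 * (l2norm R (dr R φ) + 5 / δ * S) := by
    refine (l2norm_dr_sq_mul_le hR hpφ).trans (mul_le_mul_of_nonneg_left ?_ (sq_nonneg R))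
    have h1 := hm.l2norm_mul_div_r_le hφc
    have h2 := hm.l2norm_dr_mul_le hR hδ hφ
    -- With δ ≤ 1 the 2S coming from (r²)' is at most (2/δ)S; together with (3/δ)S from p' this
    -- makes 5/δ.
    have h3 : S ≤ 1 / δ * S := by
      have : 1 ≤ 1 / δ := by rw [le_div_iff₀ hδ]; linarith
      nlinarith
    have h4 : 5 / δ * S = 2 * (1 / δ * S) + 3 / δ * S := by ring
    rw [h4]
    linarith
  refine ⟨g, S, hg, hS0, hm.l2norm_layer_le hφc, l2norm_layer_sq_le hR hφ hδ hδ1 hm, hg1, hg2, ?_⟩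
  have hgc := hg.contDiffOn.continuousOn
  have hσ2c : ContinuousOn (fun r : ℝ => (r : ℂ) * ((σ r : ℂ) ^ 2 * φ r)) (Icc 1 R) :=
    continuousOn_r_mul
      (((Complex.continuous_ofReal.comp hm.continuous_σ).pow 2).continuousOn.mul hφc)
  have hσ2 : l2norm R (fun r : ℝ => (r : ℂ) * ((σ r : ℂ) ^ 2 * φ r)) ≤ R ^ 2 * S :=
    l2norm_le_mul (memLp_of_continuousOn hσ2c) (memLp_of_continuousOn hσc) (sq_nonneg R)
      fun r hr => by
        refine (norm_r_mul_le (f := fun r => (σ r : ℂ) ^ 2 * φ r) hr).trans ?_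
        rw [mul_div_assoc, norm_mul, norm_mul, norm_pow, Complex.norm_real,
          Real.norm_of_nonneg (hm.σ_nonneg r)]
        gcongr
        exact pow_le_of_le_one (hm.σ_nonneg r) (hm.σ_le_one r) two_ne_zero
  -- δ⟨w, φ⟩ is a layer part, small through σ², plus the potential term tested with g, which the
  -- equation controls.
  have hsplit := l2inner_eq_add (f := fun r => (δ : ℂ) * w r) (g := φ) (a₁ := (δ : ℂ)) (a₂ := 1)
    (memLp_of_continuousOn hwr) (memLp_of_continuousOn hσ2c)
    (memLp_of_continuousOn (continuousOn_coeff_mul hwc lam)) (memLp_of_continuousOn hgc)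
    (fun r hr => by
      have hr' : r ≠ 0 := by linarith [hr.1]
      have hr'' : (r : ℂ) ≠ 0 := by exact_mod_cast hr'
      have hc : ((1 / r ^ 2 - lam : ℝ) : ℂ) * ((r ^ 2 : ℝ) : ℂ) * p r
          = δ * (1 - (σ r : ℂ) ^ 2) := by
        have h1 := hm.mul_p r
        have h2 : (1 / r ^ 2 - lam) * r ^ 2 * p r = δ * (1 - σ r ^ 2) := by
          rw [← h1]; field_simp
        exact_mod_cast h2
      simp only [hg_def, map_mul, map_pow, Complex.conj_ofReal]
      have hc' : (1 : ℂ) * (((1 / r ^ 2 - lam : ℝ) : ℂ) * w r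
            * (((r ^ 2 : ℝ) : ℂ) * ((p r : ℂ) * conj (φ r))))
          = (((1 / r ^ 2 - lam : ℝ) : ℂ) * ((r ^ 2 : ℝ) : ℂ) * p r) * (w r * conj (φ r)) := by
        ring
      rw [hc', hc]
      field_simp
      ring)
  have hδw : l2inner R (fun r => (δ : ℂ) * w r) φ = δ * l2inner R w φ := by
    simp only [l2inner, mul_assoc]
    exact integral_const_mul _ _
  have hen := stream_energy hR h
  set E := l2norm R (dr R φ) ^ 2 + ((k : ℝ) ^ 2 - 1 / 4) * l2norm R (fun r => φ r / r) ^ 2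
  have hE : 0 ≤ E := add_nonneg (sq_nonneg _) (mul_nonneg hk (sq_nonneg _))
  rw [hδw, one_mul] at hsplit
  have hweak := l2inner_resolventF hR hw.memH2 hg ν B lam s k
  set T := l2inner R (fun r => resolventF ν B R lam k w r - (s : ℂ) * w r) g
  set X := l2norm R (fun r => w r / r)
  set z₁ := l2inner R (fun r => w r / r) (fun r : ℝ => (r : ℂ) * ((σ r : ℂ) ^ 2 * φ r))
  set z₂ := l2inner R (fun r : ℝ => ((1 / r ^ 2 - lam : ℝ) : ℂ) * w r) g
  have hz₁ : ‖z₁‖ ≤ X * (R ^ 2 * S) :=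
    (norm_l2inner_le (memLp_of_continuousOn hwr) (memLp_of_continuousOn hσ2c)).trans
      (mul_le_mul_of_nonneg_left hσ2 (l2norm_nonneg _ _))
  have hz₃ : ‖l2inner R (dr R w) (dr R g)‖
      ≤ l2norm R (dr R w) * (R ^ 2 * (l2norm R (dr R φ) + 5 / δ * S)) :=
    (norm_l2inner_le (memLp_of_continuousOn (continuousOn_dr hR hw.memH2.contDiffOn))
      (memLp_of_continuousOn (continuousOn_dr hR hg.contDiffOn))).trans
      (mul_le_mul_of_nonneg_left hg2 (l2norm_nonneg _ _))
  have hz₄ : ‖l2inner R (fun r => w r / r) (fun r => g r / r)‖ ≤ X * (R ^ 2 * S) :=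
    (norm_l2inner_le (memLp_of_continuousOn hwr)
      (memLp_of_continuousOn (continuousOn_div_r hgc))).trans
      (mul_le_mul_of_nonneg_left hg1 (l2norm_nonneg _ _))
  have hz₅ : ‖l2inner R w g‖ ≤ X * (R ^ 2 * (R ^ 2 * S)) :=
    (norm_l2inner_le_div_mul (memLp_of_continuousOn hwr) hgc).trans
      (mul_le_mul_of_nonneg_left (mul_le_mul_of_nonneg_left hg1 (sq_nonneg R))
        (l2norm_nonneg _ _))
  set z₃ := l2inner R (dr R w) (dr R g)
  set z₄ := l2inner R (fun r => w r / r) (fun r => g r / r)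
  set z₅ := l2inner R w g
  -- The weak form is solved for the potential term. Since w and φ are different functions no term
  -- is real, so all of them, including the shift, are estimated in modulus.
  have hbz₂ : |(k * B : ℝ)| * ‖z₂‖
      ≤ ‖T‖ + s * ‖z₅‖ + ν * (‖z₃‖ + ((k : ℝ) ^ 2 - 1 / 4) * ‖z₄‖) := by
    have e : Complex.I * ((k * B : ℝ) : ℂ) * z₂
        = T + s * z₅ - ν * (z₃ + (((k : ℝ) ^ 2 - 1 / 4 : ℝ) : ℂ) * z₄) := by
      rw [hweak]; ring
    have e' := congrArg norm e
    rw [norm_mul, norm_mul, Complex.norm_I, one_mul, Complex.norm_real, Real.norm_eq_abs] at e'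
    rw [e']
    refine (norm_sub_le _ _).trans (add_le_add ((norm_add_le _ _).trans ?_) ?_)
    · rw [norm_mul, Complex.norm_real, Real.norm_of_nonneg hs]
    · rw [norm_mul, Complex.norm_real, Real.norm_of_nonneg hν]
      refine mul_le_mul_of_nonneg_left ((norm_add_le _ _).trans ?_) hν
      rw [norm_mul, Complex.norm_real, Real.norm_of_nonneg hk]
  have hδE : δ * E ≤ δ * ‖z₁‖ + ‖z₂‖ := by
    have e : ((δ * E : ℝ) : ℂ) = -((δ : ℂ) * z₁ + z₂) := by
      rw [← hsplit, Complex.ofReal_mul, hen]; ring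
    have e' := congrArg norm e
    rw [Complex.norm_real, Real.norm_of_nonneg (mul_nonneg hδ.le hE), norm_neg] at e'
    rw [e']
    refine (norm_add_le _ _).trans (le_of_eq ?_)
    rw [norm_mul, Complex.norm_real, Real.norm_of_nonneg hδ.le]
  calc |(k * B : ℝ)| * δ * E = |(k * B : ℝ)| * (δ * E) := by ring
    _ ≤ |(k * B : ℝ)| * (δ * ‖z₁‖ + ‖z₂‖) := by gcongr
    _ = |(k * B : ℝ)| * δ * ‖z₁‖ + |(k * B : ℝ)| * ‖z₂‖ := by ring
    _ ≤ |(k * B : ℝ)| * δ * ‖z₁‖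
        + (‖T‖ + s * ‖z₅‖ + ν * (‖z₃‖ + ((k : ℝ) ^ 2 - 1 / 4) * ‖z₄‖)) := by gcongr
    _ ≤ |(k * B : ℝ)| * δ * (X * (R ^ 2 * S))
        + (‖T‖ + s * (X * (R ^ 2 * (R ^ 2 * S)))
          + ν * (l2norm R (dr R w) * (R ^ 2 * (l2norm R (dr R φ) + 5 / δ * S))
            + ((k : ℝ) ^ 2 - 1 / 4) * (X * (R ^ 2 * S)))) := by gcongr
    _ = _ := by ring

end Stream

/-! ### The dual norm -/

section DualNorm

variable {R : ℝ}

lemma h1norm_nonneg (R : ℝ) (f : ℝ → ℂ) : 0 ≤ h1norm R f := Real.sqrt_nonneg _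

lemma h1norm_le_add (R : ℝ) (f : ℝ → ℂ) :
    h1norm R f ≤ l2norm R (fun r => f r / r) + l2norm R (dr R f) := by
  have h1 := l2norm_nonneg R (fun r => f r / r)
  have h2 := l2norm_nonneg R (dr R f)
  refine Real.sqrt_le_iff.2 ⟨add_nonneg h1 h2, ?_⟩
  nlinarith [mul_nonneg h1 h2]

lemma l2norm_div_r_le_h1norm (R : ℝ) (f : ℝ → ℂ) :
    l2norm R (fun r => f r / r) ≤ h1norm R f :=
  Real.le_sqrt_of_sq_le (by linarith [sq_nonneg (l2norm R (dr R f))])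

lemma norm_l2inner_le_h1norm (hR : 1 < R) {f g : ℝ → ℂ}
    (hf : MemLp f 2 (volume.restrict (Ioo 1 R))) (hg : ContinuousOn g (Icc 1 R)) :
    ‖l2inner R f g‖ ≤ l2norm R f * (R * h1norm R g) := by
  refine (norm_l2inner_le hf (memLp_of_continuousOn hg)).trans
    (mul_le_mul_of_nonneg_left ?_ (l2norm_nonneg _ _))
  have h := l2norm_sq_le hR hg
  rw [← mul_pow] at h
  have h1 := le_of_sq_le_sq h (mul_nonneg (by linarith) (l2norm_nonneg _ _))
  exact h1.trans (mul_le_mul_of_nonneg_left (l2norm_div_r_le_h1norm R g) (by linarith))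

/-- Needed because `sSup` of an unbounded set of reals is 0. The bound is crude in R, but its size
never enters the estimates. -/
lemma bddAbove_hm1norm (hR : 1 < R) {f : ℝ → ℂ} (hf : MemLp f 2 (volume.restrict (Ioo 1 R))) :
    BddAbove {x : ℝ | ∃ g : ℝ → ℂ, MemH10 R g ∧ h1norm R g ≤ 1 ∧ x = ‖l2inner R f g‖} := by
  refine ⟨l2norm R f * (R * 1), ?_⟩
  rintro x ⟨g, hg, hg1, rfl⟩
  have hgc : ContinuousOn g (Icc 1 R) := by
    have := hg.memH1.ac.continuousOn
    rwa [uIcc_of_le hR.le] at this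
  refine (norm_l2inner_le_h1norm hR hf hgc).trans
    (mul_le_mul_of_nonneg_left ?_ (l2norm_nonneg _ _))
  exact mul_le_mul_of_nonneg_left hg1 (by linarith)

lemma hm1norm_nonneg (R : ℝ) (f : ℝ → ℂ) : 0 ≤ hm1norm R f := by
  refine Real.sSup_nonneg ?_
  rintro x ⟨g, -, -, rfl⟩
  exact norm_nonneg _

lemma h1norm_const_mul_le (hR : 1 < R) {g : ℝ → ℂ} (hg : IsTest R g) {c : ℝ} (hc : 0 ≤ c) :
    h1norm R (fun r => (c : ℂ) * g r) ≤ c * h1norm R g := by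
  have hcg : IsTest R (fun r => (c : ℂ) * g r) := hg.mul_ofReal (p := fun _ => c) contDiff_const
  have h1 : l2norm R (dr R fun r => (c : ℂ) * g r) ≤ c * l2norm R (dr R g) :=
    l2norm_le_mul (memLp_of_continuousOn (continuousOn_dr hR hcg.contDiffOn))
      (memLp_of_continuousOn (continuousOn_dr hR hg.contDiffOn)) hc fun r hr => by
        rw [dr_mul_ofReal (p := fun _ => c) hg.contDiffOn contDiff_const hr]
        simp [abs_of_nonneg hc]
  have h2 : l2norm R (fun r => (c : ℂ) * g r / r) ≤ c * l2norm R (fun r => g r / r) :=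
    l2norm_le_mul (memLp_of_continuousOn (continuousOn_div_r hcg.contDiffOn.continuousOn))
      (memLp_of_continuousOn (continuousOn_div_r hg.contDiffOn.continuousOn)) hc fun r hr => by
        rw [mul_div_assoc, norm_mul, Complex.norm_real, Real.norm_of_nonneg hc]
  have h3 := pow_le_pow_left₀ (l2norm_nonneg _ _) h1 2
  have h4 := pow_le_pow_left₀ (l2norm_nonneg _ _) h2 2
  refine Real.sqrt_le_iff.2 ⟨mul_nonneg hc (h1norm_nonneg _ _), ?_⟩
  rw [h1norm, mul_pow, Real.sq_sqrt (by positivity)]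
  linarith

/-- The duality bound for test functions. -/
lemma norm_l2inner_le_hm1norm (hR : 1 < R) {f g : ℝ → ℂ}
    (hf : MemLp f 2 (volume.restrict (Ioo 1 R))) (hg : IsTest R g) :
    ‖l2inner R f g‖ ≤ hm1norm R f * h1norm R g := by
  -- A function of norm zero cannot be normalised; the crude bound then shows that its pairing
  -- vanishes.
  rcases (h1norm_nonneg R g).eq_or_lt with h0 | h0
  · have := norm_l2inner_le_h1norm hR hf hg.contDiffOn.continuousOn
    rw [← h0] at this ⊢
    simpa using this
  · set c := (h1norm R g)⁻¹ with hc
    have hc0 : 0 < c := inv_pos.2 h0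
    have hcg : IsTest R (fun r => (c : ℂ) * g r) := hg.mul_ofReal (p := fun _ => c) contDiff_const
    have h1 := le_csSup (bddAbove_hm1norm hR hf) ⟨_, hcg.memH10 hR,
      (h1norm_const_mul_le hR hg hc0.le).trans_eq (inv_mul_cancel₀ h0.ne'), rfl⟩
    have h2 : l2inner R f (fun r => (c : ℂ) * g r) = c * l2inner R f g := by
      simp only [l2inner, map_mul, Complex.conj_ofReal, mul_left_comm _ (c : ℂ)]
      exact integral_const_mul _ _
    rw [h2, norm_mul, Complex.norm_real, Real.norm_of_nonneg hc0.le, hc, inv_mul_le_iff₀ h0,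
      mul_comm] at h1
    exact h1

end DualNorm

/-! ### Closing the inequalities -/

section Algebra

variable {X Y P Q S E K M N β δ θ t κ c' R : ℝ}

/-- Here X = ‖w/r‖, Y = ‖w'‖, κ = k² - 1/4 and M = ‖rF‖. With a = βδX and d = βδ²Y, the hypotheses
for δ ≤ 1 read d² ≤ Ma and a ≤ M + 13d, whence d ≤ 14M and a ≤ (1 + 13·14)M = 183M. -/
lemma weighted_bounds (hX : 0 ≤ X) (hY : 0 ≤ Y) (hM : 0 ≤ M) (hβ : 0 < β) (hδ : 0 < δ)
    (hκ : 0 ≤ κ) (hXY : X ≤ 2 * Y)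
    (hen : β * δ ^ 3 * (Y ^ 2 + κ * X ^ 2) ≤ M * X)
    (hl : δ ≤ 1 → β * δ * X ^ 2 ≤ M * X + 13 * (β * δ ^ 2) * (X * Y)) :
    β * δ * X ≤ 183 * M ∧ β * δ ^ 2 * Y ≤ 14 * M ∧ β * δ ^ 3 * κ * X ≤ M := by
  rcases hX.eq_or_lt with h0 | hX'
  · subst h0
    have h1 : β * δ ^ 3 * Y ^ 2 ≤ 0 := by linarith
    have h2 : Y ^ 2 ≤ 0 := by
      by_contra h
      have := mul_pos (by positivity : 0 < β * δ ^ 3) (not_le.1 h)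
      linarith
    have hY0 : Y = 0 := pow_eq_zero_iff two_ne_zero |>.1 (le_antisymm h2 (sq_nonneg Y))
    subst hY0
    simp [hM]
  · have h3 : β * δ ^ 3 * κ * X ≤ M := by
      refine le_of_mul_le_mul_right ?_ hX'
      have : 0 ≤ β * δ ^ 3 * Y ^ 2 := by positivity
      linarith
    have hen' : β * δ ^ 3 * Y ^ 2 ≤ M * X := by
      have : 0 ≤ β * δ ^ 3 * (κ * X ^ 2) := by positivity
      linarith
    rcases le_or_gt δ 1 with hδ1 | hδ1
    · have ha : β * δ * X ≤ M + 13 * (β * δ ^ 2 * Y) := by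
        refine le_of_mul_le_mul_right ?_ hX'
        linarith [hl hδ1]
      have hd : (β * δ ^ 2 * Y) ^ 2 ≤ M * (β * δ * X) := by
        have := mul_le_mul_of_nonneg_left hen' (by positivity : 0 ≤ β * δ)
        linarith
      have hd0 : 0 ≤ β * δ ^ 2 * Y := by positivity
      have hd14 : β * δ ^ 2 * Y ≤ 14 * M := by
        by_contra h
        have h := not_le.1 h
        nlinarith [mul_le_mul_of_nonneg_left ha hM]
      exact ⟨by linarith, hd14, h3⟩
    -- For δ > 1 the energy and X ≤ 2Y bound βδ³Y, which dominates the lower powers of δ.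
    · have hY' : 0 < Y := by linarith
      have h1 : β * δ ^ 3 * Y ≤ 2 * M := by
        refine le_of_mul_le_mul_right ?_ hY'
        linarith [mul_le_mul_of_nonneg_left hXY hM]
      have h2 : β * δ ^ 2 * Y ≤ β * δ ^ 3 * Y := by
        have : δ ^ 2 ≤ δ ^ 3 := pow_le_pow_right₀ hδ1.le (by norm_num)
        gcongr
      have h4 : β * δ * X ≤ β * δ ^ 3 * (2 * Y) := by
        have : δ ≤ δ ^ 3 := le_self_pow₀ hδ1.le (by norm_num)
        gcongr
      exact ⟨by linarith, by linarith, h3⟩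

/-- The inequalities are multiplied by βδ³ and become quadratic in a = βδ²X, d = βδ³Y and e = βδ³X.
For δ ≤ 1 the layer estimate gives a ≤ 5N + 14d; inserted in the energy, this closes because c'·14²
is small. For δ ≥ 1 Hardy gives a ≤ e ≤ 2d instead. -/
lemma dual_bounds (hX : 0 ≤ X) (hY : 0 ≤ Y) (hN : 0 ≤ N) (hβ : 0 < β) (hδ : 0 < δ)
    (hκ : 0 ≤ κ) (hXY : X ≤ 2 * Y) (hc : c' ≤ 1 / 10000)
    (hen : β * δ ^ 3 * (Y ^ 2 + κ * X ^ 2) ≤ N * (X + Y) + c' * (β * δ) * X ^ 2)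
    (hl : δ ≤ 1 → β * δ * X ^ 2
      ≤ N * (X + (Y + 3 / δ * X)) + 13 * (β * δ ^ 2) * (X * Y)) :
    β * δ ^ 2 * X ≤ 300 * N ∧ β * δ ^ 3 * Y ≤ 20 * N
      ∧ κ * (β * δ ^ 3 * X) ^ 2 ≤ (20 * N) ^ 2 := by
  have ha0 : 0 ≤ β * δ ^ 2 * X := by positivity
  have hd0 : 0 ≤ β * δ ^ 3 * Y := by positivity
  have he0 : 0 ≤ β * δ ^ 3 * X := by positivity
  have hen' : (β * δ ^ 3 * Y) ^ 2 + κ * (β * δ ^ 3 * X) ^ 2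
      ≤ N * (β * δ ^ 3 * X + β * δ ^ 3 * Y) + c' * (β * δ ^ 2 * X) ^ 2 := by
    have := mul_le_mul_of_nonneg_left hen (by positivity : 0 ≤ β * δ ^ 3)
    linarith
  have hed : β * δ ^ 3 * X ≤ 2 * (β * δ ^ 3 * Y) := by
    have := mul_le_mul_of_nonneg_left hXY (by positivity : 0 ≤ β * δ ^ 3)
    linarith
  have hl' : δ ≤ 1 → (β * δ ^ 2 * X) ^ 2 ≤ N * (β * δ ^ 3 * X + (β * δ ^ 3 * Y
      + 3 * (β * δ ^ 2 * X))) + 13 * ((β * δ ^ 2 * X) * (β * δ ^ 3 * Y)) := fun h1 => by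
    have := mul_le_mul_of_nonneg_left (hl h1) (by positivity : 0 ≤ β * δ ^ 3)
    have e : β * δ ^ 3 * (N * (X + (Y + 3 / δ * X))) = N * (β * δ ^ 3 * X + (β * δ ^ 3 * Y
      + 3 * (β * δ ^ 2 * X))) := by field_simp
    rw [mul_add, e] at this
    linarith
  have hea : δ ≤ 1 → β * δ ^ 3 * X ≤ β * δ ^ 2 * X := fun h1 => by
    have : δ ^ 3 ≤ δ ^ 2 := pow_le_pow_of_le_one hδ.le h1 (by norm_num)
    gcongr
  have hae : 1 ≤ δ → β * δ ^ 2 * X ≤ β * δ ^ 3 * X := fun h1 => by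
    have : δ ^ 2 ≤ δ ^ 3 := pow_le_pow_right₀ h1 (by norm_num)
    gcongr
  generalize β * δ ^ 2 * X = a at *
  generalize β * δ ^ 3 * Y = d at *
  generalize β * δ ^ 3 * X = e at *
  have hca : c' * a ^ 2 ≤ 1 / 10000 * a ^ 2 := by gcongr
  have hκe : 0 ≤ κ * e ^ 2 := by positivity
  rcases le_total δ 1 with h1 | h1
  · have hl1 := hl' h1
    have hea1 := hea h1
    have hae5 : a ≤ 5 * N + 14 * d := by
      by_contra h
      have h := not_le.1 h
      have := mul_le_mul_of_nonneg_left hea1 hN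
      have h2 := mul_nonneg hN hd0
      have h3 := mul_le_mul_of_nonneg_right h.le hd0
      have h4 : a * (5 * N + 14 * d) < a * a := mul_lt_mul_of_pos_left h (by linarith)
      nlinarith [mul_nonneg hN ha0, sq_nonneg d]
    have hNe : N * e ≤ N * (5 * N + 14 * d) := by gcongr; linarith
    have ha2 : a ^ 2 ≤ (5 * N + 14 * d) ^ 2 := by gcongr
    have hd : d ≤ 20 * N := by
      by_contra h
      have h := not_le.1 h
      nlinarith [mul_nonneg hN hd0, mul_pos (by linarith : 0 < d) (by linarith : 0 < d - 20 * N)]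
    have ha' : a ≤ 285 * N := by linarith
    refine ⟨by linarith, hd, ?_⟩
    have h5 : a ^ 2 ≤ (285 * N) ^ 2 := by gcongr
    have h6 : N * (e + d) ≤ N * (285 * N + 20 * N) := by gcongr; linarith
    nlinarith [sq_nonneg d, sq_nonneg N]
  · have hae1 := hae h1
    have ha2 : a ^ 2 ≤ (2 * d) ^ 2 := by
      have : a ≤ 2 * d := by linarith
      gcongr
    have hNe : N * e ≤ N * (2 * d) := by gcongr
    have hd : d ≤ 4 * N := by
      by_contra h
      have h := not_le.1 h
      nlinarith [mul_pos (by linarith : 0 < d) (by linarith : 0 < d - 4 * N)]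
    have hNd := mul_le_mul_of_nonneg_left hd hN
    have hd2 : d ^ 2 ≤ (4 * N) ^ 2 := by gcongr
    refine ⟨by linarith, by linarith, ?_⟩
    nlinarith [sq_nonneg N, sq_nonneg d]

/-- Here P = ‖φ/r‖, Q = ‖φ'‖, K² = k² - 1/4, E² = Q² + K²P² and t = |k|^{1/2}. If θt ≤ 1, the layer
mass satisfies tS ≤ 5θE, which supplies the gain t; if θt ≥ 1, dissipation alone is strong enough.
-/
lemma stream_weighted_bound (hX : 0 ≤ X) (hP : 0 ≤ P) (hQ : 0 ≤ Q) (hM : 0 ≤ M) (hβ : 0 < β)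
    (hθ : 0 < θ) (ht : 1 ≤ t) (hE : 0 ≤ E) (htK : t ^ 2 ≤ 2 * K) (hQE : Q ≤ E)
    (hPE : K * P ≤ E) (ha : β * θ ^ 2 * X ≤ 183 * M) (hd : β * θ ^ 4 * Y ≤ 14 * M)
    (he : β * θ ^ 6 * K ^ 2 * X ≤ M)
    (hXP : E ^ 2 ≤ X * (R ^ 2 * P))
    (hl : θ ^ 2 ≤ 1 → ∃ S : ℝ, 0 ≤ S ∧ S ^ 2 ≤ 10 * θ ^ 2 * (P * Q) ∧
      β * θ ^ 2 * E ^ 2 ≤ β * θ ^ 2 * (X * (R ^ 2 * S)) + M * (R ^ 2 * S)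
        + β * θ ^ 6 * (Y * (R ^ 2 * (Q + 5 / θ ^ 2 * S)) + K ^ 2 * (X * (R ^ 2 * S)))) :
    β * θ * t * (Q + t ^ 2 * P) ≤ 4500 * (R ^ 2 * M) := by
  have htP : t ^ 2 * P ≤ 2 * E := by
    have := mul_le_mul_of_nonneg_right htK hP
    linarith
  have hRM : 0 ≤ R ^ 2 * M := by positivity
  suffices hmain : β * θ * t * E ≤ 1500 * (R ^ 2 * M) by
    have : Q + t ^ 2 * P ≤ 3 * E := by linarith
    have := mul_le_mul_of_nonneg_left this (by positivity : 0 ≤ β * θ * t)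
    linarith
  rcases hE.eq_or_lt with h0 | hE'
  · rw [← h0]; linarith
  rcases le_total (θ * t) 1 with h1 | h1
  · have hθ1 : θ ≤ 1 := by nlinarith
    obtain ⟨S, hS0, hS, hmain⟩ := hl (pow_le_one₀ hθ.le hθ1)
    have hSt : t * S ≤ 5 * θ * E := by
      refine le_of_sq_le_sq ?_ (by positivity)
      have h2 : t ^ 2 * P * Q ≤ 2 * E * E := by gcongr
      calc (t * S) ^ 2 = t ^ 2 * S ^ 2 := by ring
        _ ≤ t ^ 2 * (10 * θ ^ 2 * (P * Q)) := by gcongr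
        _ = 10 * θ ^ 2 * (t ^ 2 * P * Q) := by ring
        _ ≤ 10 * θ ^ 2 * (2 * E * E) := by gcongr
        _ ≤ (5 * θ * E) ^ 2 := by nlinarith [sq_nonneg (θ * E)]
    have h3 : β * θ ^ 2 * E ^ 2 ≤ R ^ 2 * M * (255 * S + 14 * θ ^ 2 * Q) := by
      have e : β * θ ^ 6 * (Y * (R ^ 2 * (Q + 5 / θ ^ 2 * S)) + K ^ 2 * (X * (R ^ 2 * S)))
          = R ^ 2 * ((β * θ ^ 4 * Y) * (θ ^ 2 * Q + 5 * S) + (β * θ ^ 6 * K ^ 2 * X) * S) := by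
        field_simp
      rw [e] at hmain
      have i1 := mul_le_mul_of_nonneg_right ha hS0
      have i2 := mul_le_mul_of_nonneg_right hd (by positivity : 0 ≤ θ ^ 2 * Q + 5 * S)
      have i3 := mul_le_mul_of_nonneg_right he hS0
      have i4 := mul_le_mul_of_nonneg_left (add_le_add i1 (add_le_add i2 i3)) (sq_nonneg R)
      linarith
    have h4 : θ ^ 2 * Q * t ≤ θ * E := by
      calc θ ^ 2 * Q * t = θ * (θ * t) * Q := by ring
        _ ≤ θ * 1 * E := by gcongr
        _ = θ * E := by ring
    refine le_of_mul_le_mul_right ?_ (by positivity : 0 < θ * E)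
    calc β * θ * t * E * (θ * E) = β * θ ^ 2 * E ^ 2 * t := by ring
      _ ≤ R ^ 2 * M * (255 * S + 14 * θ ^ 2 * Q) * t := by gcongr
      _ = R ^ 2 * M * (255 * (t * S) + 14 * (θ ^ 2 * Q * t)) := by ring
      _ ≤ R ^ 2 * M * (255 * (5 * θ * E) + 14 * (θ * E)) := by gcongr
      _ ≤ 1500 * (R ^ 2 * M) * (θ * E) := by
        have := mul_nonneg hRM (by positivity : 0 ≤ θ * E)
        linarith
  -- High frequencies: the elliptic bound gives t²E ≤ 2R²X, the energy bounds βθ⁶K²X, and θt ≤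
  -- (θt)⁶.
  · have h2 : t ^ 2 * E ≤ 2 * (R ^ 2 * X) := by
      refine le_of_mul_le_mul_right ?_ hE'
      have := mul_le_mul_of_nonneg_left htP (by positivity : 0 ≤ R ^ 2 * X)
      have h5 := mul_le_mul_of_nonneg_left hXP (sq_nonneg t)
      linarith
    have h3 : t ^ 4 ≤ 4 * K ^ 2 := by
      have := pow_le_pow_left₀ (sq_nonneg t) htK 2
      linarith
    have h4 : θ * t ≤ (θ * t) ^ 6 := le_self_pow₀ h1 (by norm_num)
    calc β * θ * t * E = β * (θ * t) * E := by ring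
      _ ≤ β * (θ * t) ^ 6 * E := by gcongr
      _ = β * θ ^ 6 * t ^ 4 * (t ^ 2 * E) := by ring
      _ ≤ β * θ ^ 6 * (4 * K ^ 2) * (2 * (R ^ 2 * X)) := by gcongr
      _ = 8 * R ^ 2 * (β * θ ^ 6 * K ^ 2 * X) := by ring
      _ ≤ 8 * R ^ 2 * M := by gcongr
      _ ≤ _ := by linarith

/-- Same notation as in `stream_weighted_bound`. The layer mass S ≤ 5θE gives the estimate for θ ≤
1; for θ ≥ 1 the elliptic bound and the energy suffice, since 2K ≥ 1. -/
lemma stream_dual_bound (hX : 0 ≤ X) (hP : 0 ≤ P) (hQ : 0 ≤ Q) (hN : 0 ≤ N) (hβ : 0 < β)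
    (hθ : 0 < θ) (ht : 1 ≤ t) (hE : 0 ≤ E) (hK : 0 ≤ K) (htK : t ^ 2 ≤ 2 * K) (hQE : Q ≤ E)
    (hPE : K * P ≤ E) (hc : c' ≤ 1)
    (ha : β * θ ^ 4 * X ≤ 300 * N) (hd : β * θ ^ 6 * Y ≤ 20 * N)
    (he : K * (β * θ ^ 6 * X) ≤ 20 * N)
    (hXP : E ^ 2 ≤ X * (R ^ 2 * P))
    (hl : θ ^ 2 ≤ 1 → ∃ S : ℝ, 0 ≤ S ∧ S ≤ P ∧ S ^ 2 ≤ 10 * θ ^ 2 * (P * Q) ∧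
      β * θ ^ 2 * E ^ 2 ≤ β * θ ^ 2 * (X * (R ^ 2 * S))
        + N * (R ^ 2 * S + R ^ 2 * (Q + 5 / θ ^ 2 * S)) + c' * (β * θ ^ 2) * (X * (R ^ 2 * S))
        + β * θ ^ 6 * (Y * (R ^ 2 * (Q + 5 / θ ^ 2 * S)) + K ^ 2 * (X * (R ^ 2 * S)))) :
    β * θ ^ 3 * (Q + t ^ 2 * P) ≤ 12000 * (R ^ 2 * N) := by
  have htP : t ^ 2 * P ≤ 2 * E := by
    have := mul_le_mul_of_nonneg_right htK hP
    linarith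
  have hRN : 0 ≤ R ^ 2 * N := by positivity
  have hP2 : P ≤ 2 * E := (le_mul_of_one_le_left hP (one_le_pow₀ ht)).trans htP
  suffices hmain : β * θ ^ 3 * E ≤ 4000 * (R ^ 2 * N) by
    have : Q + t ^ 2 * P ≤ 3 * E := by linarith
    have := mul_le_mul_of_nonneg_left this (by positivity : 0 ≤ β * θ ^ 3)
    linarith
  rcases hE.eq_or_lt with h0 | hE'
  · rw [← h0]; linarith
  rcases le_total θ 1 with hθ1 | hθ1
  · obtain ⟨S, hS0, hSP, hS, hmain⟩ := hl (pow_le_one₀ hθ.le hθ1)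
    have hS5 : S ≤ 5 * θ * E := by
      refine le_of_sq_le_sq ?_ (by positivity)
      calc S ^ 2 ≤ 10 * θ ^ 2 * (P * Q) := hS
        _ ≤ 10 * θ ^ 2 * (2 * E * E) := by gcongr
        _ ≤ (5 * θ * E) ^ 2 := by nlinarith [sq_nonneg (θ * E)]
    -- Only KX, not K²X, is controlled by the dual norm, so K²XS is split as (KX)(KS) with KS ≤ KP ≤
    -- E.
    have hKS : K * S ≤ E := (mul_le_mul_of_nonneg_left hSP hK).trans hPE
    have hθ2 : θ ^ 2 ≤ θ := pow_le_of_le_one hθ.le hθ1 two_ne_zero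
    have hθ21 : θ ^ 2 ≤ 1 := hθ2.trans hθ1
    have h3 : β * θ ^ 4 * E ^ 2 ≤ R ^ 2 * N * (732 * S + 41 * (θ * E)) := by
      have hm := mul_le_mul_of_nonneg_left hmain (sq_nonneg θ)
      have e : θ ^ 2 * (β * θ ^ 2 * (X * (R ^ 2 * S))
          + N * (R ^ 2 * S + R ^ 2 * (Q + 5 / θ ^ 2 * S)) + c' * (β * θ ^ 2) * (X * (R ^ 2 * S))
          + β * θ ^ 6 * (Y * (R ^ 2 * (Q + 5 / θ ^ 2 * S)) + K ^ 2 * (X * (R ^ 2 * S))))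
          = R ^ 2 * ((1 + c') * ((β * θ ^ 4 * X) * S) + N * (θ ^ 2 * S + θ ^ 2 * Q + 5 * S)
            + (β * θ ^ 6 * Y) * (θ ^ 2 * Q + 5 * S)
            + θ ^ 2 * (K * (β * θ ^ 6 * X) * (K * S))) := by
        field_simp
        ring
      rw [e] at hm
      have hQ' : θ ^ 2 * Q ≤ θ * E := by gcongr
      have i1 : (1 + c') * ((β * θ ^ 4 * X) * S) ≤ 2 * (300 * N * S) := by
        gcongr
        linarith
      have i2 : N * (θ ^ 2 * S + θ ^ 2 * Q + 5 * S) ≤ N * (1 * S + θ * E + 5 * S) := by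
        gcongr
      have i3 : (β * θ ^ 6 * Y) * (θ ^ 2 * Q + 5 * S) ≤ 20 * N * (θ * E + 5 * S) := by
        gcongr
      have i4 : θ ^ 2 * (K * (β * θ ^ 6 * X) * (K * S)) ≤ θ * (20 * N * E) := by
        gcongr
      have i5 := mul_le_mul_of_nonneg_left (add_le_add (add_le_add (add_le_add i1 i2) i3) i4)
        (sq_nonneg R)
      have i6 := mul_nonneg hRN hS0
      linarith
    refine le_of_mul_le_mul_right ?_ (by positivity : 0 < θ * E)
    calc β * θ ^ 3 * E * (θ * E) = β * θ ^ 4 * E ^ 2 := by ring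
      _ ≤ R ^ 2 * N * (732 * S + 41 * (θ * E)) := h3
      _ ≤ R ^ 2 * N * (732 * (5 * θ * E) + 41 * (θ * E)) := by gcongr
      _ ≤ 4000 * (R ^ 2 * N) * (θ * E) := by
        have := mul_nonneg hRN (by positivity : 0 ≤ θ * E)
        linarith
  · have hEX : E ≤ 2 * (R ^ 2 * X) := by
      refine le_of_mul_le_mul_right ?_ hE'
      have := mul_le_mul_of_nonneg_left hP2 (by positivity : 0 ≤ R ^ 2 * X)
      linarith
    have hK2 : 1 ≤ 2 * K := by nlinarith
    have hθ36 : θ ^ 3 ≤ θ ^ 6 := pow_le_pow_right₀ hθ1 (by norm_num)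
    calc β * θ ^ 3 * E ≤ β * θ ^ 6 * (2 * (R ^ 2 * X)) := by gcongr
      _ = 1 * (2 * R ^ 2 * (β * θ ^ 6 * X)) := by ring
      _ ≤ 2 * K * (2 * R ^ 2 * (β * θ ^ 6 * X)) := by gcongr
      _ = 4 * R ^ 2 * (K * (β * θ ^ 6 * X)) := by ring
      _ ≤ 4 * R ^ 2 * (20 * N) := by gcongr
      _ ≤ _ := by linarith

end Algebra

/-! ### Resolvent bounds in terms of β and θ -/

section Resolvent

variable {R : ℝ}

lemma three_fourths_mul_sq_le {k : ℤ} (hk : 1 ≤ |k|) :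
    3 / 4 * (k : ℝ) ^ 2 ≤ (k : ℝ) ^ 2 - 1 / 4 := by
  have h1 : (1 : ℝ) ≤ |(k : ℝ)| := by exact_mod_cast hk
  have h2 : 1 ≤ (k : ℝ) ^ 2 := by rw [← sq_abs]; exact one_le_pow₀ h1
  linarith

lemma norm_l2inner_le_weighted {f F g : ℝ → ℂ}
    (hf : MemLp f 2 (volume.restrict (Ioo 1 R))) (hg : ContinuousOn g (Icc 1 R))
    (hF : ∀ r, F r = r * f r) :
    ‖l2inner R f g‖ ≤ l2norm R F * l2norm R (fun r => g r / r) := by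
  have hFL : MemLp F 2 (volume.restrict (Ioo 1 R)) := by
    have : F = fun r : ℝ => (r : ℂ) * f r := funext hF
    rw [this]
    refine (hf.const_mul (R : ℂ)).mono
      (Complex.continuous_ofReal.aestronglyMeasurable.mul hf.1) ?_
    filter_upwards [ae_restrict_mem measurableSet_Ioo] with r hr
    rw [norm_mul, norm_mul, Complex.norm_real, Complex.norm_real]
    gcongr
    rw [Real.norm_of_nonneg (by linarith [hr.1]), Real.norm_of_nonneg (by linarith [hr.1, hr.2])]
    exact hr.2.le
  have e : l2inner R f g = l2inner R F (fun r => g r / r) :=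
    l2inner_congr fun r hr => by
      have h0 : (r : ℂ) ≠ 0 := by
        have : (0 : ℝ) < r := by linarith [hr.1]
        exact_mod_cast this.ne'
      rw [hF, map_div₀, Complex.conj_ofReal]
      field_simp
  rw [e]
  exact norm_l2inner_le hFL (memLp_of_continuousOn (continuousOn_div_r hg))

lemma memLp_r_mul_resolventF (hR : 1 < R) {w : ℝ → ℂ} (hw : MemH2 R w) (ν B lam s : ℝ) (k : ℤ) :
    MemLp (fun r : ℝ => (r : ℂ) * resolventF ν B R lam k w r - (s : ℂ) * (w r / r)) 2
      (volume.restrict (Ioo 1 R)) := by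
  have hF := memLp_resolventF hw ν B lam k
  refine MemLp.sub ((hF.const_mul (R : ℂ)).mono
    (Complex.continuous_ofReal.aestronglyMeasurable.mul hF.1) ?_)
    ((memLp_of_continuousOn (continuousOn_div_r hw.contDiffOn.continuousOn)).const_mul _)
  filter_upwards [ae_restrict_mem measurableSet_Ioo] with r hr
  rw [norm_mul, norm_mul, Complex.norm_real, Complex.norm_real]
  gcongr
  rw [Real.norm_of_nonneg (by linarith [hr.1]), Real.norm_of_nonneg (by linarith)]
  exact hr.2.le

lemma rpow_mul_rpow_layer {β θ a b : ℝ} (hβ : 0 < β) (hθ : 0 < θ) (hab : a + b = 1) :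
    (β * θ ^ 6) ^ a * β ^ b = β * θ ^ (6 * a) := by
  rw [Real.mul_rpow hβ.le (by positivity), mul_right_comm, ← Real.rpow_add hβ, hab, Real.rpow_one,
    ← Real.rpow_natCast θ 6, ← Real.rpow_mul hθ.le]
  norm_num

/-- Resolvent estimates with a weighted `L²` right-hand side, in terms of `β = |k B|` and
`θ = (ν / β) ^ (1 / 6)`. -/
lemma weighted_resolvent_bounds (hR : 1 < R) {w : ℝ → ℂ} (hw : MemDomain R w) {β θ : ℝ}
    (B lam : ℝ) {k : ℤ} (hk : 1 ≤ |k|) (hβ : 0 < β) (hβB : |(k * B : ℝ)| = β) (hθ : 0 < θ)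
    {c' : ℝ} (hc0 : 0 ≤ c') (hc : c' ≤ 1 / 10000) {M : ℝ}
    (hM : M = l2norm R (fun r => r * resolventF (β * θ ^ 6) B R lam k w r
      - ((c' * (β * θ ^ 2) : ℝ) : ℂ) * (w r / r))) :
    (β * θ ^ 4 * l2norm R (dr R w) + β * θ ^ 2 * l2norm R (fun r => w r / r) ≤ 400 * M) ∧
    ∀ φ, IsStream R k w φ → ∀ t, 1 ≤ t → t ^ 2 = |(k : ℝ)| →
      β * θ * t * (l2norm R (dr R φ) + t ^ 2 * l2norm R (fun r => φ r / r))
        ≤ 9000 * (R ^ 2 * M) := by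
  set M₀ := l2norm R (fun r : ℝ => (r : ℂ) * (resolventF (β * θ ^ 6) B R lam k w r
    - ((0 : ℝ) : ℂ) * w r)) with hM₀
  have hM₀0 : 0 ≤ M₀ := l2norm_nonneg _ _
  have hν : 0 ≤ β * θ ^ 6 := by positivity
  have hδ : 0 < θ ^ 2 := by positivity
  have hk' := three_fourths_mul_sq_le hk
  have hκ : 0 ≤ (k : ℝ) ^ 2 - 1 / 4 := by linarith [sq_nonneg (k : ℝ)]
  have hwc := hw.memH2.contDiffOn.continuousOn
  have hF : MemLp (fun r : ℝ => resolventF (β * θ ^ 6) B R lam k w r - ((0 : ℝ) : ℂ) * w r) 2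
      (volume.restrict (Ioo 1 R)) :=
    (memLp_resolventF hw.memH2 _ B lam k).sub ((memLp_of_continuousOn hwc).const_mul _)
  have htest : ∀ g, IsTest R g → ‖l2inner R (fun r : ℝ => resolventF (β * θ ^ 6) B R lam k w r
      - ((0 : ℝ) : ℂ) * w r) g‖ ≤ M₀ * l2norm R (fun r => g r / r) := fun g hg =>
    norm_l2inner_le_weighted hF hg.contDiffOn.continuousOn fun _ => rfl
  have hen := (energy_le hR hw (β * θ ^ 6) B lam le_rfl k).trans
    (add_le_add_left (htest w hw.isTest) _)
  have hlayer : θ ^ 2 ≤ 1 → β * θ ^ 2 * l2norm R (fun r => w r / r) ^ 2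
      ≤ M₀ * l2norm R (fun r => w r / r)
        + 13 * (β * (θ ^ 2) ^ 2) * (l2norm R (fun r => w r / r) * l2norm R (dr R w)) := by
    intro h1
    obtain ⟨p, A, σ, hm⟩ := exists_isMultiplier lam hδ h1
    have h := layer_estimate hR hw hν B 0 k hδ h1 hm
    have h2 := (htest _ (hw.isTest.mul_ofReal hm.contDiff_p)).trans (mul_le_mul_of_nonneg_left
      ((hm.l2norm_mul_div_r_le hwc).trans (hm.l2norm_layer_le hwc)) hM₀0)
    rw [hβB] at h
    have e : β * θ ^ 6 * (3 / θ ^ 2) = 3 * (β * (θ ^ 2) ^ 2) := by field_simp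
    rw [e] at h
    linarith
  obtain ⟨ha, hd, he⟩ := weighted_bounds (l2norm_nonneg _ _) (l2norm_nonneg _ _) hM₀0 hβ hδ hκ
    (l2norm_div_r_le hR hw.isTest)
    (by rw [← pow_mul]; linarith) hlayer
  simp only [← pow_mul, Nat.reduceMul] at hd he
  -- The shift contributes at most c'·183M₀ ≤ M₀/2, which is absorbed.
  have hMM : M₀ ≤ 2 * M := by
    have h := l2norm_le_add (R := R)
      (h := fun r : ℝ => (r : ℂ) * (resolventF (β * θ ^ 6) B R lam k w r
        - ((0 : ℝ) : ℂ) * w r))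
      (by simpa using memLp_r_mul_resolventF hR hw.memH2 (β * θ ^ 6) B lam 0 k)
      (memLp_r_mul_resolventF hR hw.memH2 (β * θ ^ 6) B lam (c' * (β * θ ^ 2)) k)
      (memLp_of_continuousOn (continuousOn_div_r hwc)) zero_le_one
      (by positivity : 0 ≤ c' * (β * θ ^ 2)) (fun r _ => by
        have e : (r : ℂ) * (resolventF (β * θ ^ 6) B R lam k w r - ((0 : ℝ) : ℂ) * w r)
            = (r * resolventF (β * θ ^ 6) B R lam k w r
              - ((c' * (β * θ ^ 2) : ℝ) : ℂ) * (w r / r))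
              + ((c' * (β * θ ^ 2) : ℝ) : ℂ) * (w r / r) := by
          push_cast; ring
        rw [e, one_mul]
        refine (norm_add_le _ _).trans (add_le_add_right (le_of_eq ?_) _)
        rw [norm_mul, Complex.norm_real, Real.norm_of_nonneg (by positivity)])
    rw [← hM, ← hM₀] at h
    have h2 : c' * (β * θ ^ 2 * l2norm R (fun r => w r / r)) ≤ 1 / 10000 * (183 * M₀) :=
      mul_le_mul hc ha (mul_nonneg (by positivity) (l2norm_nonneg _ _)) (by norm_num)
    linarith
  refine ⟨by linarith, fun φ hφ t ht htk => ?_⟩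
  have hR2 := mul_le_mul_of_nonneg_left hMM (sq_nonneg R)
  set Q := l2norm R (dr R φ) with hQ
  set P := l2norm R (fun r => φ r / r) with hP
  have hP0 : 0 ≤ P := l2norm_nonneg _ _
  have hQ0 : 0 ≤ Q := l2norm_nonneg _ _
  have hK2 := Real.sq_sqrt hκ
  have hE0 : 0 ≤ Q ^ 2 + ((k : ℝ) ^ 2 - 1 / 4) * P ^ 2 := by positivity
  have hE2 := Real.sq_sqrt hE0
  have h := stream_weighted_bound (X := l2norm R fun r => w r / r) (Y := l2norm R (dr R w))
    (P := P) (Q := Q) (E := √(Q ^ 2 + ((k : ℝ) ^ 2 - 1 / 4) * P ^ 2))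
    (K := √((k : ℝ) ^ 2 - 1 / 4)) (M := M₀) (β := β) (θ := θ) (t := t) (R := R)
    (l2norm_nonneg _ _) hP0 hQ0 hM₀0 hβ hθ ht (Real.sqrt_nonneg _)
    -- t² = |k| ≤ 2K because k² ≤ 4(k² - 1/4).
    (by
      refine le_of_sq_le_sq ?_ (by positivity)
      rw [htk, sq_abs, mul_pow, hK2]
      linarith)
    (Real.le_sqrt_of_sq_le (by linarith [mul_nonneg hκ (sq_nonneg P)]))
    (Real.le_sqrt_of_sq_le (by rw [mul_pow, hK2]; linarith [sq_nonneg Q]))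
    ha hd (by rw [hK2]; exact he)
    (by rw [hE2]; exact stream_energy_le hR hw hφ)
    (fun h1 => by
      obtain ⟨p, A, σ, hm⟩ := exists_isMultiplier lam hδ h1
      obtain ⟨g, S, hg, hS0, -, hS2, hg1, -, hfin⟩ :=
        stream_layer_estimate hR hw hφ hκ hν le_rfl B hδ h1 hm
      refine ⟨S, hS0, hS2, ?_⟩
      rw [hE2, hK2]
      rw [hβB] at hfin
      have := (htest g hg).trans (mul_le_mul_of_nonneg_left hg1 hM₀0)
      linarith)
  linarith

/-- Resolvent estimates with a right-hand side in the dual norm, in terms of `β = |k B|` and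
`θ = (ν / β) ^ (1 / 6)`. -/
lemma dual_resolvent_bounds (hR : 1 < R) {w : ℝ → ℂ} (hw : MemDomain R w) {β θ : ℝ}
    (B lam : ℝ) {k : ℤ} (hk : 1 ≤ |k|) (hβ : 0 < β) (hβB : |(k * B : ℝ)| = β) (hθ : 0 < θ)
    {c' : ℝ} (hc0 : 0 ≤ c') (hc : c' ≤ 1 / 10000) {N : ℝ}
    (hN : N = hm1norm R (fun r => resolventF (β * θ ^ 6) B R lam k w r
      - ((c' * (β * θ ^ 2) / R ^ 2 : ℝ) : ℂ) * w r)) :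
    (β * θ ^ 6 * h1norm R w + β * θ ^ 4 * l2norm R (fun r => w r / r) ≤ 400 * N) ∧
    ∀ φ, IsStream R k w φ → ∀ t, 1 ≤ t → t ^ 2 = |(k : ℝ)| →
      β * θ ^ 3 * (l2norm R (dr R φ) + t ^ 2 * l2norm R (fun r => φ r / r))
        ≤ 12000 * (R ^ 2 * N) := by
  have hR0 : 0 < R := by linarith
  have hN0 : 0 ≤ N := hN ▸ hm1norm_nonneg _ _
  have hν : 0 ≤ β * θ ^ 6 := by positivity
  have hδ : 0 < θ ^ 2 := by positivity
  have hs : 0 ≤ c' * (β * θ ^ 2) / R ^ 2 := by positivity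
  have hsR : c' * (β * θ ^ 2) / R ^ 2 * R ^ 2 = c' * (β * θ ^ 2) := by field_simp
  have hk' := three_fourths_mul_sq_le hk
  have hk1 : (1 : ℝ) ≤ (k : ℝ) ^ 2 := by
    rw [← sq_abs]; exact one_le_pow₀ (by exact_mod_cast hk)
  have hκ : 0 ≤ (k : ℝ) ^ 2 - 1 / 4 := by linarith
  have hwc := hw.memH2.contDiffOn.continuousOn
  -- The division by R² makes s‖w‖² ≤ c'βθ²‖w/r‖². Unlike in the weighted case the shift is kept
  -- throughout and absorbed in `dual_bounds`.
  set s := c' * (β * θ ^ 2) / R ^ 2 with hs_def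
  have hF : MemLp (fun r : ℝ => resolventF (β * θ ^ 6) B R lam k w r - (s : ℂ) * w r) 2
      (volume.restrict (Ioo 1 R)) :=
    (memLp_resolventF hw.memH2 _ B lam k).sub ((memLp_of_continuousOn hwc).const_mul _)
  have htest : ∀ g, IsTest R g → ‖l2inner R (fun r : ℝ => resolventF (β * θ ^ 6) B R lam k w r
      - (s : ℂ) * w r) g‖ ≤ N * (l2norm R (fun r => g r / r) + l2norm R (dr R g)) := fun g hg => by
    refine (norm_l2inner_le_hm1norm hR hF hg).trans ?_
    rw [← hN]
    exact mul_le_mul_of_nonneg_left (h1norm_le_add R g) hN0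
  have hen := (energy_le hR hw (β * θ ^ 6) B lam hs k).trans
    (add_le_add_left (htest w hw.isTest) _)
  rw [hsR] at hen
  have hlayer : θ ^ 2 ≤ 1 → β * θ ^ 2 * l2norm R (fun r => w r / r) ^ 2
      ≤ N * (l2norm R (fun r => w r / r)
          + (l2norm R (dr R w) + 3 / θ ^ 2 * l2norm R (fun r => w r / r)))
        + 13 * (β * (θ ^ 2) ^ 2) * (l2norm R (fun r => w r / r) * l2norm R (dr R w)) := by
    intro h1
    obtain ⟨p, A, σ, hm⟩ := exists_isMultiplier lam hδ h1
    have h := layer_estimate hR hw hν B s k hδ h1 hm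
    have h3 := hm.l2norm_layer_le hwc
    have h2 := (htest _ (hw.isTest.mul_ofReal hm.contDiff_p)).trans (mul_le_mul_of_nonneg_left
      (add_le_add ((hm.l2norm_mul_div_r_le hwc).trans h3)
        ((hm.l2norm_dr_mul_le hR hδ hw.isTest).trans
          (add_le_add_right (mul_le_mul_of_nonneg_left h3 (by positivity)) _))) hN0)
    rw [hβB] at h
    have e : β * θ ^ 6 * (3 / θ ^ 2) = 3 * (β * (θ ^ 2) ^ 2) := by field_simp
    rw [e] at h
    linarith
  obtain ⟨ha, hd, he⟩ := dual_bounds (l2norm_nonneg _ _) (l2norm_nonneg _ _) hN0 hβ hδ hκ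
    (l2norm_div_r_le hR hw.isTest) hc
    (by rw [← pow_mul]; linarith) hlayer
  simp only [← pow_mul, Nat.reduceMul] at ha hd he
  have hK2 := Real.sq_sqrt hκ
  have hKe : √((k : ℝ) ^ 2 - 1 / 4) * (β * θ ^ 6 * l2norm R (fun r => w r / r)) ≤ 20 * N := by
    refine le_of_sq_le_sq ?_ (by positivity)
    rw [mul_pow, hK2]
    exact he
  have hX0 : 0 ≤ β * θ ^ 6 * l2norm R (fun r => w r / r) :=
    mul_nonneg (by positivity) (l2norm_nonneg _ _)
  constructor
  · have hK1 : 1 / 2 ≤ √((k : ℝ) ^ 2 - 1 / 4) := Real.le_sqrt_of_sq_le (by linarith)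
    have h1 := mul_le_mul_of_nonneg_right hK1 hX0
    have h2 := mul_le_mul_of_nonneg_left (h1norm_le_add R w) hν
    linarith
  · intro φ hφ t ht htk
    set Q := l2norm R (dr R φ) with hQ
    set P := l2norm R (fun r => φ r / r) with hP
    have hP0 : 0 ≤ P := l2norm_nonneg _ _
    have hQ0 : 0 ≤ Q := l2norm_nonneg _ _
    have hE0 : 0 ≤ Q ^ 2 + ((k : ℝ) ^ 2 - 1 / 4) * P ^ 2 := by positivity
    have hE2 := Real.sq_sqrt hE0
    exact stream_dual_bound (X := l2norm R fun r => w r / r) (Y := l2norm R (dr R w))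
      (P := P) (Q := Q) (E := √(Q ^ 2 + ((k : ℝ) ^ 2 - 1 / 4) * P ^ 2))
      (K := √((k : ℝ) ^ 2 - 1 / 4)) (N := N) (β := β) (θ := θ) (t := t) (R := R) (c' := c')
      (l2norm_nonneg _ _) hP0 hQ0 hN0 hβ hθ ht (Real.sqrt_nonneg _) (Real.sqrt_nonneg _)
      (by
        refine le_of_sq_le_sq ?_ (by positivity)
        rw [htk, sq_abs, mul_pow, hK2]
        linarith)
      (Real.le_sqrt_of_sq_le (by linarith [mul_nonneg hκ (sq_nonneg P)]))
      (Real.le_sqrt_of_sq_le (by rw [mul_pow, hK2]; linarith [sq_nonneg Q]))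
      (by linarith) ha hd hKe
      (by rw [hE2]; exact stream_energy_le hR hw hφ)
      (fun h1 => by
        obtain ⟨p, A, σ, hm⟩ := exists_isMultiplier lam hδ h1
        obtain ⟨g, S, hg, hS0, hSP, hS2, hg1, hg2, hfin⟩ :=
          stream_layer_estimate hR hw hφ hκ hν hs B hδ h1 hm
        refine ⟨S, hS0, hSP, hS2, ?_⟩
        rw [hE2, hK2]
        rw [hβB] at hfin
        have h2 := (htest g hg).trans (mul_le_mul_of_nonneg_left (add_le_add hg1 hg2) hN0)
        have e : s * (l2norm R (fun r => w r / r) * (R ^ 2 * (R ^ 2 * S)))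
            = c' * (β * θ ^ 2) * (l2norm R (fun r => w r / r) * (R ^ 2 * S)) := by
          rw [← hsR]; ring
        rw [e] at hfin
        linarith)

end Resolvent

end TaylorCouette

/-! ### Assembly of the four estimates -/

theorem proposition3p2 :
    ∃ C c : ℝ, 0 < C ∧ 0 < c ∧
      ∀ (ν B R lam : ℝ) (k : ℤ) (w : ℝ → ℂ) (c' : ℝ),
        0 < ν → B ≠ 0 → 1 < R → 1 ≤ |k| → TaylorCouette.MemDomain R w → 0 ≤ c' → c' ≤ c →
        (ν ^ (2 / 3 : ℝ) * |k * B| ^ (1 / 3 : ℝ) * TaylorCouette.l2norm R (TaylorCouette.dr R w)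
            + ν ^ (1 / 3 : ℝ) * |k * B| ^ (2 / 3 : ℝ)
              * TaylorCouette.l2norm R (fun r => w r / r)
          ≤ C * TaylorCouette.l2norm R (fun r =>
              r * TaylorCouette.resolventF ν B R lam k w r
                - ((c' * ν ^ (1 / 3 : ℝ) * |k * B| ^ (2 / 3 : ℝ) : ℝ) : ℂ) * (w r / r)))
        ∧ (ν * TaylorCouette.h1norm R w
            + ν ^ (2 / 3 : ℝ) * |k * B| ^ (1 / 3 : ℝ)
              * TaylorCouette.l2norm R (fun r => w r / r)
          ≤ C * TaylorCouette.hm1norm R (fun r =>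
              TaylorCouette.resolventF ν B R lam k w r
                - ((c' * ν ^ (1 / 3 : ℝ) * |k * B| ^ (2 / 3 : ℝ) / R ^ 2 : ℝ) : ℂ) * w r))
        ∧ ∀ φ : ℝ → ℂ, TaylorCouette.IsStream R k w φ →
          (ν ^ (1 / 6 : ℝ) * |k * B| ^ (5 / 6 : ℝ) * (|k| : ℝ) ^ (1 / 2 : ℝ)
              * (TaylorCouette.l2norm R (TaylorCouette.dr R φ)
                + |k| * TaylorCouette.l2norm R (fun r => φ r / r))
            ≤ C * R ^ 2 * ((ν / |k * B|) ^ (1 / 6 : ℝ) * Real.log R ^ (1 / 2 : ℝ) + 1)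
              * TaylorCouette.l2norm R (fun r =>
                r * TaylorCouette.resolventF ν B R lam k w r
                  - ((c' * ν ^ (1 / 3 : ℝ) * |k * B| ^ (2 / 3 : ℝ) : ℝ) : ℂ) * (w r / r)))
          ∧ (ν ^ (1 / 2 : ℝ) * |k * B| ^ (1 / 2 : ℝ)
                * TaylorCouette.l2norm R (TaylorCouette.dr R φ)
              + ν ^ (1 / 2 : ℝ) * |k| * |k * B| ^ (1 / 2 : ℝ)
                * TaylorCouette.l2norm R (fun r => φ r / r)
            ≤ C * R ^ 2 * TaylorCouette.hm1norm R (fun r =>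
                TaylorCouette.resolventF ν B R lam k w r
                  - ((c' * ν ^ (1 / 3 : ℝ) * |k * B| ^ (2 / 3 : ℝ) / R ^ 2 : ℝ) : ℂ)
                    * w r)) := by
  refine ⟨12000, 1 / 10000, by norm_num, by norm_num, ?_⟩
  intro ν B R lam k w c' hν hB hR hk hw hc0 hc
  have hk1 : (1 : ℝ) ≤ |(k : ℝ)| := by exact_mod_cast hk
  have hβ : 0 < |(k * B : ℝ)| :=
    abs_pos.2 (mul_ne_zero (abs_pos.1 (by linarith)) hB)
  obtain ⟨β, hβB⟩ : ∃ β, |(k * B : ℝ)| = β := ⟨_, rfl⟩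
  -- θ = (ν/β)^{1/6} turns the fractional powers into integer powers of θ.
  obtain ⟨θ, hθ, hνθ⟩ : ∃ θ : ℝ, 0 < θ ∧ ν = β * θ ^ 6 := by
    rw [hβB] at hβ
    refine ⟨(ν / β) ^ (1 / 6 : ℝ), by positivity, ?_⟩
    rw [← Real.rpow_natCast, ← Real.rpow_mul (by positivity)]
    norm_num
    field_simp
  rw [hβB] at hβ
  subst hνθ
  have e23 : (β * θ ^ 6) ^ (2 / 3 : ℝ) * β ^ (1 / 3 : ℝ) = β * θ ^ 4 := by
    rw [TaylorCouette.rpow_mul_rpow_layer hβ hθ (by norm_num), ← Real.rpow_natCast]; norm_num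
  have e13 : (β * θ ^ 6) ^ (1 / 3 : ℝ) * β ^ (2 / 3 : ℝ) = β * θ ^ 2 := by
    rw [TaylorCouette.rpow_mul_rpow_layer hβ hθ (by norm_num), ← Real.rpow_natCast]; norm_num
  have e16 : (β * θ ^ 6) ^ (1 / 6 : ℝ) * β ^ (5 / 6 : ℝ) = β * θ := by
    rw [TaylorCouette.rpow_mul_rpow_layer hβ hθ (by norm_num)]; norm_num
  have e12 : (β * θ ^ 6) ^ (1 / 2 : ℝ) * β ^ (1 / 2 : ℝ) = β * θ ^ 3 := by
    rw [TaylorCouette.rpow_mul_rpow_layer hβ hθ (by norm_num), ← Real.rpow_natCast]; norm_num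
  have ht1 : 1 ≤ |(k : ℝ)| ^ (1 / 2 : ℝ) := Real.one_le_rpow hk1 (by norm_num)
  have ht2 : (|(k : ℝ)| ^ (1 / 2 : ℝ)) ^ 2 = |(k : ℝ)| := by
    rw [← Real.sqrt_eq_rpow, Real.sq_sqrt (abs_nonneg _)]
  obtain ⟨h1, h2⟩ := TaylorCouette.weighted_resolvent_bounds hR hw B lam hk hβ hβB hθ hc0 hc rfl
  obtain ⟨h3, h4⟩ := TaylorCouette.dual_resolvent_bounds hR hw B lam hk hβ hβB hθ hc0 hc rfl
  have hR2 : 0 < R ^ 2 := by positivity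
  simp only [hβB, mul_assoc c', e23, e13, e16]
  have hM0 := TaylorCouette.l2norm_nonneg R (fun r : ℝ =>
    (r : ℂ) * TaylorCouette.resolventF (β * θ ^ 6) B R lam k w r
      - ((c' * (β * θ ^ 2) : ℝ) : ℂ) * (w r / r))
  have hN0 := TaylorCouette.hm1norm_nonneg R (fun r : ℝ =>
    TaylorCouette.resolventF (β * θ ^ 6) B R lam k w r
      - ((c' * (β * θ ^ 2) / R ^ 2 : ℝ) : ℂ) * w r)
  refine ⟨by linarith, by linarith, fun φ hφ => ⟨?_, ?_⟩⟩
  · have h := h2 φ hφ _ ht1 ht2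
    rw [ht2] at h
    rw [Int.cast_abs]
    refine h.trans ?_
    -- The bound obtained has no logarithm; the logarithmic term is nonnegative and is simply added.
    have hlog : 0 ≤ (β * θ ^ 6 / β) ^ (1 / 6 : ℝ) * Real.log R ^ (1 / 2 : ℝ) :=
      mul_nonneg (Real.rpow_nonneg (by positivity) _)
        (Real.rpow_nonneg (Real.log_nonneg hR.le) _)
    have h5 := mul_nonneg (mul_nonneg hR2.le hM0) hlog
    have h6 := mul_nonneg hR2.le hM0
    linarith
  · have h := h4 φ hφ _ ht1 ht2
    rw [ht2] at h
    rw [Int.cast_abs, mul_right_comm _ |(k : ℝ)|, e12]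
    linarith
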